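/- For a finite sequence $a$ in a totally ordered set, let $\mathrm{LA}(a)$ be the largest $m$ such that $a$ has a subsequence $b_1,\dots,b_m$ of length $m$ (indices increasing) with $b_1>b_2<b_3>b_4<\cdots$. Let $\Lambda$ be a finite totally ordered set, and let $(x_k)_{k\ge 0}$ be an ergodic (irreducible and aperiodic) Markov chain on $\Lambda$ with transition matrix $P=(p_{r,s})$, started from its stationary distribution $\pi$. Put $$\mathrm{Osc}(x)=\sum_{t<s>r}\frac{\pi_t\,p_{t,s}\,p_{s,r}}{1-p_{s,s}}+\sum_{t>s<r}\frac{\pi_t\,p_{t,s}\,p_{s,r}}{1-p_{s,s}} .$$ The gradient $y$ of the chain takes values in $\{1,-1\}$: after a step from $r$ to $s$ it is $1$ if $s>r$, it is $-1$ if $s<r$, and it is unchanged if $s=r$. Then $(x_k,y_{k-1},y_k)$ is a Markov chain on $\Lambda\times\{1,-1\}^2$. A transition $(r,a,b)\to(s,b,c)$, where $c$ is the new gradient, has probability $p_{r,s}$, and all other transitions have probability $0$. Its stationary measure is $$\tilde\pi_{(r,a,b)}=\sum_{s}\pi_{(s,a)}\,p_{s,r},$$ where the sum is over those $s$ for which the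 step from $s$ to $r$ turns the gradient $a$ into $b$, and where $$\pi_{(s,1)}=\frac{\sum_{t<s}\pi_t\,p_{t,s}}{1-p_{s,s}},\qquad \pi_{(s,-1)}=\frac{\sum_{t>s}\pi_t\,p_{t,s}}{1-p_{s,s}} .$$ Let $f(r,a,b)=\mathbf 1(ab=-1)$, let $(Z_t)_{t\ge 0}$ be this chain started from $\tilde\pi$, and put $$\gamma^2=\mathrm{Var}\,f(Z_0)+2\sum_{t\ge1}\mathrm{Cov}\bigl(f(Z_0),f(Z_t)\bigr).$$ (If $\Lambda$ has one element, then $\mathrm{Osc}(x)$ and $\gamma^2$ are read as $0$.) Then the series defining $\gamma^2$ converges absolutely, $\gamma^2\in[0,\infty)$, and $\gamma^2$ is the asymptotic variance of $\mathrm{LA}$, in the sense that $$\lim_{n\to\infty}\frac1n\,\mathrm{Var}\bigl(\mathrm{LA}(x_0,\dots,x_n)\bigr)=\gamma^2 .$$ Moreover, if $\gamma^2\neq0$, then with $\gamma=\sqrt{\gamma^2}>0$, $$\frac{\mathrm{LA}(x_0,\dots,x_n)-n\,\mathrm{Osc}(x)}{\sqrt n\,\gamma}\Longrightarrow \mathcal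 N(0,1)\qquad(n\to\infty),$$ where $\Longrightarrow$ denotes convergence in distribution. -/

import Mathlib

open MeasureTheory ProbabilityTheory Filter Topology

noncomputable section

namespace MarkovAlt

/-! ### Longest alternating subsequences -/

/-- The finite sequence `b 0, b 1, …, b (m - 1)` is alternating: `b 0 > b 1 < b 2 > b 3 < ⋯`. -/
def IsAlternating {Λ : Type*} [LinearOrder Λ] {m : ℕ} (b : Fin m → Λ) : Prop :=
  ∀ (i : ℕ) (h : i + 1 < m),
    (Even i → b ⟨i + 1, h⟩ < b ⟨i, Nat.lt_of_succ_lt h⟩) ∧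
    (Odd i → b ⟨i, Nat.lt_of_succ_lt h⟩ < b ⟨i + 1, h⟩)

/-- The length of the longest alternating subsequence of a finite sequence `a`. -/
def longestAlt {Λ : Type*} [LinearOrder Λ] {n : ℕ} (a : Fin n → Λ) : ℕ :=
  sSup {m : ℕ | ∃ ℓ : Fin m → Fin n, StrictMono ℓ ∧ IsAlternating (a ∘ ℓ)}

/-- The supremum in `longestAlt` is a maximum. -/
theorem longestAlt_isGreatest {Λ : Type*} [LinearOrder Λ] {n : ℕ} (a : Fin n → Λ) :
    IsGreatest {m : ℕ | ∃ ℓ : Fin m → Fin n, StrictMono ℓ ∧ IsAlternating (a ∘ ℓ)}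
      (longestAlt a) := by
  have hb : BddAbove {m : ℕ | ∃ ℓ : Fin m → Fin n, StrictMono ℓ ∧ IsAlternating (a ∘ ℓ)} := by
    refine ⟨n, ?_⟩
    rintro m ⟨ℓ, hℓ, -⟩
    simpa using Fintype.card_le_of_injective ℓ hℓ.injective
  refine ⟨Nat.sSup_mem ⟨0, Fin.elim0, fun i => i.elim0, ?_⟩ hb, fun m hm => le_csSup hb hm⟩
  intro i h
  omega

/-! ### Finite Markov chains -/

/-- `π` is a stationary probability distribution for the transition matrix `P`. -/
structure IsStationaryDist {Λ : Type*} [Fintype Λ] (P : Matrix Λ Λ ℝ) (π : Λ → ℝ) : Prop where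
  nonneg : ∀ r, 0 ≤ π r
  sum_eq_one : ∑ r, π r = 1
  stationary : ∀ r, ∑ s, π s * P s r = π r

/-- `P` is aperiodic: for every state `r`, the greatest common divisor of the times `n ≥ 1` at
which a return from `r` to `r` has positive probability is `1`. -/
def IsAperiodic {Λ : Type*} [Fintype Λ] [DecidableEq Λ] (P : Matrix Λ Λ ℝ) : Prop :=
  ∀ (r : Λ) (d : ℕ), (∀ n : ℕ, 1 ≤ n → 0 < (P ^ n) r r → d ∣ n) → d = 1

/-- `P` is the transition matrix of an ergodic chain: stochastic, irreducible and aperiodic. -/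
structure IsErgodicTransition {Λ : Type*} [Fintype Λ] [DecidableEq Λ] (P : Matrix Λ Λ ℝ) :
    Prop where
  stochastic : P ∈ Matrix.rowStochastic ℝ Λ
  irreducible : P.IsIrreducible
  aperiodic : IsAperiodic P

/-- `x 0, x 1, x 2, …` is a Markov chain on `Λ` with initial distribution `π` and transition
matrix `P`. The Markov property
`ℙ (x (n+1) = s (n+1) | x 0 = s 0, …, x n = s n) = P (s n) (s (n+1))`
is written multiplicatively, so that nothing is required at conditions of probability zero. -/
structure IsMarkovChain {Λ Ω : Type*} [MeasurableSpace Λ] [MeasurableSpace Ω]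
    (μ : Measure Ω) (π : Λ → ℝ) (P : Matrix Λ Λ ℝ) (x : ℕ → Ω → Λ) : Prop where
  measurable : ∀ n, Measurable (x n)
  initial : ∀ r, μ.real {ω | x 0 ω = r} = π r
  markov : ∀ (n : ℕ) (s : ℕ → Λ),
    μ.real {ω | ∀ k ≤ n + 1, x k ω = s k} =
      μ.real {ω | ∀ k ≤ n, x k ω = s k} * P (s n) (s (n + 1))

/-! ### The oscillation of a chain -/

/-- `Osc⁺ = ∑_{t < s > r} π_t p_{t,s} p_{s,r} / (1 - p_{s,s})`. -/
def oscPos {Λ : Type*} [Fintype Λ] [LinearOrder Λ] (P : Matrix Λ Λ ℝ) (π : Λ → ℝ) : ℝ :=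
  ∑ t, ∑ s, ∑ r, if t < s ∧ r < s then π t * P t s * P s r / (1 - P s s) else 0

/-- `Osc⁻ = ∑_{t > s < r} π_t p_{t,s} p_{s,r} / (1 - p_{s,s})`. -/
def oscNeg {Λ : Type*} [Fintype Λ] [LinearOrder Λ] (P : Matrix Λ Λ ℝ) (π : Λ → ℝ) : ℝ :=
  ∑ t, ∑ s, ∑ r, if s < t ∧ s < r then π t * P t s * P s r / (1 - P s s) else 0

/-- The oscillation `Osc = Osc⁺ + Osc⁻`. -/
def osc {Λ : Type*} [Fintype Λ] [LinearOrder Λ] (P : Matrix Λ Λ ℝ) (π : Λ → ℝ) : ℝ :=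
  oscPos P π + oscNeg P π

/-! ### The chain with gradient information and the asymptotic variance

The gradient `y` takes values in `ℤˣ = {1, -1}`. -/

/-- The gradient after a step from `r` to `s`, when the gradient before the step was `y`. -/
def nextGrad {Λ : Type*} [LinearOrder Λ] (r s : Λ) (y : ℤˣ) : ℤˣ :=
  if r < s then 1 else if s < r then -1 else y

/-- The transition matrix of the chain `(x_k, y_{k-1}, y_k)`. -/
def gradMatrix {Λ : Type*} [LinearOrder Λ] (P : Matrix Λ Λ ℝ) :
    Matrix (Λ × ℤˣ × ℤˣ) (Λ × ℤˣ × ℤˣ) ℝ :=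
  fun u v => if v.2.1 = u.2.2 ∧ v.2.2 = nextGrad u.1 v.1 u.2.2 then P u.1 v.1 else 0

/-- The stationary measure of the chain `(x_k, y_k)`:
`π_{(s,1)} = (1 - p_{s,s})⁻¹ ∑_{t < s} π_t p_{t,s}` and
`π_{(s,-1)} = (1 - p_{s,s})⁻¹ ∑_{t > s} π_t p_{t,s}`. -/
def pairDist {Λ : Type*} [Fintype Λ] [LinearOrder Λ] (P : Matrix Λ Λ ℝ) (π : Λ → ℝ)
    (s : Λ) (y : ℤˣ) : ℝ :=
  (1 - P s s)⁻¹ * ∑ t, if (y = 1 ∧ t < s) ∨ (y = -1 ∧ s < t) then π t * P t s else 0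

/-- The stationary measure of the chain `(x_k, y_{k-1}, y_k)`. -/
def gradDist {Λ : Type*} [Fintype Λ] [LinearOrder Λ] (P : Matrix Λ Λ ℝ) (π : Λ → ℝ)
    (u : Λ × ℤˣ × ℤˣ) : ℝ :=
  ∑ s, if u.2.2 = nextGrad s u.1 u.2.1 then pairDist P π s u.2.1 * P s u.1 else 0

/-- The indicator `𝟏 (y_{k-1} y_k = -1)` of a change of direction. -/
def turn {Λ : Type*} (u : Λ × ℤˣ × ℤˣ) : ℝ :=
  if u.2.1 * u.2.2 = -1 then 1 else 0

/-- The covariance `Cov (turn (Z 0), turn (Z t))` for the stationary version `Z` of the chain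
`(x_k, y_{k-1}, y_k)`. -/
def turnCov {Λ : Type*} [Fintype Λ] [LinearOrder Λ] (P : Matrix Λ Λ ℝ) (π : Λ → ℝ)
    (t : ℕ) : ℝ :=
  (∑ u, ∑ v, gradDist P π u * turn u * (gradMatrix P ^ t) u v * turn v)
    - (∑ u, gradDist P π u * turn u) ^ 2

/-- The asymptotic variance
`γ² = Var (turn (Z 0)) + 2 ∑_{t ≥ 1} Cov (turn (Z 0), turn (Z t))`. -/
def asymptoticVariance {Λ : Type*} [Fintype Λ] [LinearOrder Λ] (P : Matrix Λ Λ ℝ)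
    (π : Λ → ℝ) : ℝ :=
  turnCov P π 0 + 2 * ∑' t : ℕ, turnCov P π (t + 1)

end MarkovAlt

end

/-! Along a path, a longest alternating subsequence can be taken with one entry at the end of each
monotone run, so its length is one plus the number of direction changes. The initial gradient must
be 1: the pattern begins with a descent, so an initial descent counts as a change and an initial
ascent does not (`longestAlt_eq_turnCount`). The changes are the sum of f = `turn` along the chain
(x_k, y_{k-1}, y_k), and the mean m of f under `gradDist` is `osc` (`sum_gradDist_turn`). What
remains is a variance asymptotic and a central limit theorem for an additive functional of a finite
chain with matrix G = `gradMatrix P`.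

G need not be irreducible (no ascent ends in the least state), but a strict ascent erases the old
gradient, so some power of G has a positive column (`IsErgodicTransition.isMixing_gradMatrix`).
Doeblin contraction then gives geometric ergodicity, hence absolute convergence of the covariance
series, and g = ∑ G^t (f - m) solves g - Gg = f - m. The centred sum is therefore a martingale with
increments g(v) - (Gg)(u), plus bounded boundary terms (`sum_sub_mean_eq_addFun`). Both γ² and the
stationary mean square of these increments equal ∑ ρ (g² - (Gg)²), where ρ = `gradDist P π`
(`IsMixing.autoCov_add_tsum`); so γ² ≥ 0.

Solving the Poisson equation once more gives a corrector b for which the conditional mean of D² +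
b(v), given u, is σ² + b(u). It makes the second moment of the martingale linear in n up to a
bounded term. It also makes the characteristic function, weighted by 1 - θ²b/2, pick up the factor
exp(-σ²θ²/2) at each step up to O(θ³); for θ = t/√n the n errors vanish in the limit. None of this
needs the augmented chain to start in equilibrium, so the artificial initial gradient is harmless.
-/

namespace MarkovAlt

/-! ### Longest alternating subsequences and direction changes -/

section Combinatorics

variable {Λ : Type*} [LinearOrder Λ]

/-- The gradient of the sequence `c` after `n` steps, with initial gradient `1`. -/
def gradSeq (c : ℕ → Λ) : ℕ → ℤˣ
  | 0 => 1
  | n + 1 => nextGrad (c n) (c (n + 1)) (gradSeq c n)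

/-- The number of direction changes of the sequence `c` in its first `n` steps. -/
def turnCount (c : ℕ → Λ) : ℕ → ℕ
  | 0 => 0
  | n + 1 => turnCount c n + if gradSeq c n * gradSeq c (n + 1) = -1 then 1 else 0

/-- `ℓ` picks an alternating subsequence of length `m` of `c 0, …, c n`. -/
structure IsAltSub (c : ℕ → Λ) (n m : ℕ) (ℓ : ℕ → ℕ) : Prop where
  lt : ∀ i, i + 1 < m → ℓ i < ℓ (i + 1)
  le : ∀ i < m, ℓ i ≤ n
  even : ∀ i, i + 1 < m → Even i → c (ℓ (i + 1)) < c (ℓ i)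
  odd : ∀ i, i + 1 < m → Odd i → c (ℓ i) < c (ℓ (i + 1))

/-- Each turn flips the gradient, which starts at 1. This ties the current gradient to the parity
that governs the alternating pattern. -/
theorem gradSeq_eq_iff_even (c : ℕ → Λ) (n : ℕ) :
    (gradSeq c n = 1 ↔ Even (turnCount c n)) := by
  induction n with
  | zero => simp [gradSeq, turnCount]
  | succ n ih =>
    rw [turnCount]
    rcases Int.units_eq_one_or (gradSeq c n) with h | h <;>
    rcases Int.units_eq_one_or (gradSeq c (n + 1)) with h' | h' <;>
    simp_all [Nat.even_add_one]

theorem IsAltSub.mono {c : ℕ → Λ} {n n' m m' : ℕ} {ℓ : ℕ → ℕ} (h : IsAltSub c n m ℓ)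
    (hm : m' ≤ m) (hn : ∀ i < m', ℓ i ≤ n') : IsAltSub c n' m' ℓ where
  lt i hi := h.lt i (hi.trans_le hm)
  le := hn
  even i hi := h.even i (hi.trans_le hm)
  odd i hi := h.odd i (hi.trans_le hm)

theorem IsAltSub.lt_last {c : ℕ → Λ} {n m : ℕ} {ℓ : ℕ → ℕ} (h : IsAltSub c n (m + 1) ℓ)
    (i : ℕ) (hi : i < m) : ℓ i < ℓ m := by
  have : ∀ j, i + 1 + j ≤ m → ℓ i < ℓ (i + 1 + j) := by
    intro j
    induction j with
    | zero => intro hj; exact h.lt i (by omega)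
    | succ j ih => intro hj; exact (ih (by omega)).trans (h.lt _ (by omega))
  simpa [show i + 1 + (m - (i + 1)) = m by omega] using this (m - (i + 1)) (by omega)

theorem IsAltSub.snoc {c : ℕ → Λ} {n n' m : ℕ} {ℓ : ℕ → ℕ} (h : IsAltSub c n m ℓ) (hn : n < n')
    (heven : ∀ i, i + 1 = m → Even i → c n' < c (ℓ i))
    (hodd : ∀ i, i + 1 = m → Odd i → c (ℓ i) < c n') :
    IsAltSub c n' (m + 1) (Function.update ℓ m n') := by
  have key : ∀ i, i + 1 < m + 1 → (i + 1 < m ∨ i + 1 = m) ∧ i ≠ m := fun i hi => by omega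
  constructor
  · intro i hi
    obtain ⟨h1 | h1, h2⟩ := key i hi
    · simpa [Function.update_of_ne h2, Function.update_of_ne h1.ne] using h.lt i h1
    · have := h.le i (by omega)
      rw [h1]; simp [Function.update_of_ne h2]; omega
  · intro i hi
    rcases eq_or_ne i m with rfl | h2
    · simp
    · rw [Function.update_of_ne h2]
      exact (h.le i (by omega)).trans hn.le
  · intro i hi he
    obtain ⟨h1 | h1, h2⟩ := key i hi
    · simpa [Function.update_of_ne h2, Function.update_of_ne h1.ne] using h.even i h1 he
    · rw [h1]; simpa [Function.update_of_ne h2] using heven i h1 he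
  · intro i hi he
    obtain ⟨h1 | h1, h2⟩ := key i hi
    · simpa [Function.update_of_ne h2, Function.update_of_ne h1.ne] using h.odd i h1 he
    · rw [h1]; simpa [Function.update_of_ne h2] using hodd i h1 he

/-- The clause about equality carries the induction. A subsequence of maximal length ends at a value
that the path has already matched or passed in its current direction. Hence a step that keeps the
direction cannot supply the next entry, which would have to lie on the other side. -/
theorem IsAltSub.le_turnCount {c : ℕ → Λ} (n : ℕ) : ∀ (m : ℕ) (ℓ : ℕ → ℕ), IsAltSub c n m ℓ →
    m ≤ turnCount c n + 1 ∧ (m = turnCount c n + 1 →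
      (gradSeq c n = 1 → c (ℓ (turnCount c n)) ≤ c n) ∧
      (gradSeq c n = -1 → c n ≤ c (ℓ (turnCount c n)))) := by
  induction n with
  | zero =>
    intro m ℓ h
    have h1 : m ≤ 1 := by
      by_contra hm
      have := h.lt 0 (by omega)
      have := h.le 1 (by omega)
      simp at *; omega
    refine ⟨by simpa [turnCount] using h1, fun hm => ?_⟩
    have := h.le 0 (by omega)
    simp_all [turnCount]
  | succ n ih =>
    intro m ℓ h
    have hpar := gradSeq_eq_iff_even c n
    have hpar' : gradSeq c n = -1 → Odd (turnCount c n) := fun h1 => by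
      rw [← Nat.not_even_iff_odd, ← hpar, h1]; decide
    -- either the last index is used or not
    have hcases : IsAltSub c n m ℓ ∨ ∃ k, m = k + 1 ∧ ℓ k = n + 1 ∧ IsAltSub c n k ℓ := by
      rcases m with _ | k
      · exact Or.inl (h.mono le_rfl (by simp))
      · rcases eq_or_ne (ℓ k) (n + 1) with hk | hk
        · exact Or.inr ⟨k, rfl, hk, h.mono (Nat.le_succ k) fun i hi => by
            have := h.lt_last i hi; omega⟩
        · have := h.le k (by omega)
          refine Or.inl (h.mono le_rfl fun i hi => ?_)
          rcases Nat.lt_succ_iff_lt_or_eq.mp hi with hi | rfl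
          · have := h.lt_last i hi; omega
          · omega
    generalize hτ : turnCount c n = τ at *
    rcases hcases with hs | ⟨k, rfl, hk, hs⟩
    · obtain ⟨h1, h2⟩ := ih m ℓ hs
      rcases Int.units_eq_one_or (gradSeq c n) with hy | hy <;>
      rcases lt_trichotomy (c n) (c (n + 1)) with hc | hc | hc <;>
      simp [turnCount, gradSeq, nextGrad, hy, hc, hc.not_gt, hτ] at h2 ⊢ <;>
      first
      | omega
      | exact ⟨h1, fun hm => (h2 hm).trans hc.le⟩
      | exact ⟨h1, fun hm => hc.le.trans (h2 hm)⟩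
      | exact ⟨h1, fun hm => by simpa [hc] using h2 hm⟩
    · obtain ⟨h1, h2⟩ := ih k ℓ hs
      have he := h.even τ
      have ho := h.odd τ
      rcases Int.units_eq_one_or (gradSeq c n) with hy | hy <;>
      rcases lt_trichotomy (c n) (c (n + 1)) with hc | hc | hc <;>
      simp only [turnCount, gradSeq, nextGrad, hy, hc, hc.not_gt, hτ, if_true, if_false, lt_irrefl]
        at h2 ⊢ <;>
      rcases h1.lt_or_eq with hlt | rfl <;> simp_all <;> grind

/-- Greedy construction that keeps the last chosen index at the current time: a step without a turn
moves the last entry forward, and a turn appends a new entry. -/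
theorem exists_isAltSub (c : ℕ → Λ) (n : ℕ) :
    ∃ ℓ, IsAltSub c n (turnCount c n + 1) ℓ ∧ ℓ (turnCount c n) = n := by
  induction n with
  | zero => exact ⟨id, ⟨by simp [turnCount], by simp [turnCount], by simp [turnCount],
      by simp [turnCount]⟩, by simp [turnCount]⟩
  | succ n ih =>
    obtain ⟨ℓ, h, hl⟩ := ih
    have hpar := gradSeq_eq_iff_even c n
    have hpar' : gradSeq c n = -1 → Odd (turnCount c n) := fun h1 => by
      rw [← Nat.not_even_iff_odd, ← hpar, h1]; decide
    generalize hτ : turnCount c n = τ at *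
    -- No turn: drop the entry at `n` and put `n + 1` in its place. A peak is only raised and a
    -- valley only lowered, so the comparison with the previous entry survives.
    have hext : (Even τ → c n < c (n + 1) ∨ c n = c (n + 1)) →
        (Odd τ → c (n + 1) < c n ∨ c n = c (n + 1)) →
        ∃ ℓ', IsAltSub c (n + 1) (τ + 1) ℓ' ∧ ℓ' τ = n + 1 := by
      intro h1 h2
      have hp : IsAltSub c n τ ℓ := h.mono (Nat.le_succ τ) fun i hi => h.le i (by omega)
      refine ⟨_, hp.snoc (Nat.lt_succ_self n) (fun i hi hE => ?_) (fun i hi hO => ?_),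
        Function.update_self ..⟩
      · have h3 := h.even i (by omega) hE
        rw [hi, hl] at h3
        rcases h2 (by rw [← hi]; exact hE.add_one) with h4 | h4
        · exact h4.trans h3
        · exact h4 ▸ h3
      · have h3 := h.odd i (by omega) hO
        rw [hi, hl] at h3
        rcases h1 (by rw [← hi]; exact hO.add_one) with h4 | h4
        · exact h3.trans h4
        · exact h4 ▸ h3
    have happ : (Even τ → c (n + 1) < c n) → (Odd τ → c n < c (n + 1)) →
        ∃ ℓ', IsAltSub c (n + 1) (τ + 1 + 1) ℓ' ∧ ℓ' (τ + 1) = n + 1 := by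
      intro h1 h2
      refine ⟨_, h.snoc (Nat.lt_succ_self n) (fun i hi hE => ?_) (fun i hi hO => ?_),
        Function.update_self ..⟩
      · obtain rfl : i = τ := by omega
        rw [hl]; exact h1 hE
      · obtain rfl : i = τ := by omega
        rw [hl]; exact h2 hO
    rcases Int.units_eq_one_or (gradSeq c n) with hy | hy <;>
    rcases lt_trichotomy (c n) (c (n + 1)) with hc | hc | hc <;>
    simp [turnCount, gradSeq, nextGrad, hy, hc, hc.not_gt, hτ] <;>
    grind

/-- The length of the longest alternating subsequence is one more than the number of direction
changes. -/
theorem longestAlt_eq_turnCount (c : ℕ → Λ) (n : ℕ) :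
    longestAlt (fun i : Fin (n + 1) => c i) = turnCount c n + 1 := by
  obtain ⟨⟨ℓ, hmono, halt⟩, hub⟩ := longestAlt_isGreatest (fun i : Fin (n + 1) => c i)
  apply le_antisymm
  · have key : ∀ (m : ℕ) (ℓ : Fin m → Fin (n + 1)), StrictMono ℓ →
        IsAlternating ((fun i : Fin (n + 1) => c i) ∘ ℓ) → m ≤ turnCount c n + 1 := by
      intro m ℓ hm ha
      refine (IsAltSub.le_turnCount n m (fun i => if h : i < m then ℓ ⟨i, h⟩ else 0) ?_).1
      constructor
      · intro i hi
        have hi' : i < m := by omega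
        simpa [hi, hi'] using hm (show (⟨i, hi'⟩ : Fin m) < ⟨i + 1, hi⟩ by simp)
      · intro i hi
        simpa [hi] using Nat.lt_succ_iff.mp (ℓ ⟨i, hi⟩).2
      · intro i hi hE
        have hi' : i < m := by omega
        simpa [hi, hi'] using (ha i hi).1 hE
      · intro i hi hO
        have hi' : i < m := by omega
        simpa [hi, hi'] using (ha i hi).2 hO
    exact key _ ℓ hmono halt
  · obtain ⟨ℓ, h, -⟩ := exists_isAltSub c n
    refine hub ⟨fun i => ⟨ℓ i, Nat.lt_succ_iff.mpr (h.le i i.2)⟩, ?_, ?_⟩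
    · exact Fin.strictMono_iff_lt_succ.mpr fun i => by
        simpa using h.lt i (by omega)
    · exact fun i hi => ⟨h.even i hi, h.odd i hi⟩

theorem gradSeq_congr {c d : ℕ → Λ} {n : ℕ} (h : ∀ k ≤ n, c k = d k) :
    gradSeq c n = gradSeq d n := by
  induction n with
  | zero => rfl
  | succ n ih =>
    rw [gradSeq, gradSeq, ih fun k hk => h k (hk.trans (Nat.le_succ n)), h n (Nat.le_succ n),
      h (n + 1) le_rfl]

end Combinatorics

/-! ### Finite stochastic matrices: mixing and the Poisson equation -/

section Mixing

open Matrix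

variable {S : Type*} [Fintype S]

theorem mulVec_mono {G : Matrix S S ℝ} (hG : ∀ u v, 0 ≤ G u v) {h k : S → ℝ}
    (hk : ∀ u, h u ≤ k u) (u : S) : (G *ᵥ h) u ≤ (G *ᵥ k) u :=
  Finset.sum_le_sum fun v _ => mul_le_mul_of_nonneg_left (hk v) (hG u v)

theorem mulVec_const {G : Matrix S S ℝ} (hG : ∀ u, ∑ v, G u v = 1) (m : ℝ) (u : S) :
    (G *ᵥ fun _ => m) u = m := by
  simp [mulVec, dotProduct, ← Finset.sum_mul, hG]

/-- A stochastic matrix maps functions with values in `[m, M]` to such functions. -/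
theorem mulVec_mem_Icc {G : Matrix S S ℝ} (hG : ∀ u v, 0 ≤ G u v) (hG1 : ∀ u, ∑ v, G u v = 1)
    {h : S → ℝ} {m M : ℝ} (hh : ∀ u, h u ∈ Set.Icc m M) (u : S) :
    (G *ᵥ h) u ∈ Set.Icc m M := by
  constructor
  · simpa [mulVec_const hG1] using mulVec_mono hG (fun v => (hh v).1) u
  · simpa [mulVec_const hG1] using mulVec_mono hG (fun v => (hh v).2) u

/-- Doeblin contraction: if one column of a stochastic matrix is bounded below by `ε`, then the
matrix contracts ranges of functions by the factor `1 - ε`. -/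
theorem mulVec_mem_Icc_of_le {K : Matrix S S ℝ} (hK : ∀ u v, 0 ≤ K u v)
    (hK1 : ∀ u, ∑ v, K u v = 1) {z : S} {ε : ℝ} (hε : ∀ u, ε ≤ K u z)
    {h : S → ℝ} {m M : ℝ} (hh : ∀ u, h u ∈ Set.Icc m M) (u : S) :
    (K *ᵥ h) u ∈ Set.Icc (ε * h z + (1 - ε) * m) (ε * h z + (1 - ε) * M) := by
  have key : ∀ a : ℝ, (K *ᵥ h) u - a = ∑ v, K u v * (h v - a) := by
    intro a
    simp [mulVec, dotProduct, mul_sub, ← Finset.sum_mul, hK1]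
  constructor
  · have h1 : K u z * (h z - m) ≤ ∑ v, K u v * (h v - m) :=
      Finset.single_le_sum (f := fun v => K u v * (h v - m))
        (fun v _ => mul_nonneg (hK u v) (sub_nonneg.2 (hh v).1)) (Finset.mem_univ z)
    have h2 := mul_le_mul_of_nonneg_right (hε u) (sub_nonneg.2 (hh z).1)
    have := key m
    linarith
  · have h1 : K u z * (M - h z) ≤ ∑ v, K u v * (M - h v) :=
      Finset.single_le_sum (f := fun v => K u v * (M - h v))
        (fun v _ => mul_nonneg (hK u v) (sub_nonneg.2 (hh v).2)) (Finset.mem_univ z)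
    have h2 := mul_le_mul_of_nonneg_right (hε u) (sub_nonneg.2 (hh z).2)
    have h3 := key M
    have h4 : ∑ v, K u v * (h v - M) = - ∑ v, K u v * (M - h v) := by
      rw [← Finset.sum_neg_distrib]
      exact Finset.sum_congr rfl fun v _ => by ring
    linarith

variable {G : Matrix S S ℝ} {ρ : S → ℝ}

theorem IsStationaryDist.dotProduct_mulVec (hρ : IsStationaryDist G ρ) (h : S → ℝ) :
    ρ ⬝ᵥ (G *ᵥ h) = ρ ⬝ᵥ h := by
  rw [Matrix.dotProduct_mulVec]
  congr 1
  funext r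
  exact hρ.stationary r

theorem IsStationaryDist.dotProduct_const (hρ : IsStationaryDist G ρ) (m : ℝ) :
    (ρ ⬝ᵥ fun _ => m) = m := by
  simp [dotProduct, ← Finset.sum_mul, hρ.sum_eq_one]

theorem IsStationaryDist.dotProduct_mem_Icc (hρ : IsStationaryDist G ρ) {h : S → ℝ} {m M : ℝ}
    (hh : ∀ u, h u ∈ Set.Icc m M) : ρ ⬝ᵥ h ∈ Set.Icc m M := by
  constructor
  · rw [← hρ.dotProduct_const m]
    exact Finset.sum_le_sum fun v _ => mul_le_mul_of_nonneg_left (hh v).1 (hρ.nonneg v)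
  · rw [← hρ.dotProduct_const M]
    exact Finset.sum_le_sum fun v _ => mul_le_mul_of_nonneg_left (hh v).2 (hρ.nonneg v)

variable [DecidableEq S]

/-- `G` is a stochastic matrix such that some power of it has a positive column. -/
structure IsMixing (G : Matrix S S ℝ) : Prop where
  nonneg : ∀ u v, 0 ≤ G u v
  sum_eq_one : ∀ u, ∑ v, G u v = 1
  exists_pos : ∃ (N : ℕ) (z : S), 0 < N ∧ ∀ u, 0 < (G ^ N) u z

theorem IsMixing.mem_rowStochastic (hG : IsMixing G) : G ∈ Matrix.rowStochastic ℝ S :=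
  Matrix.mem_rowStochastic_iff_sum.2 ⟨hG.nonneg, hG.sum_eq_one⟩

theorem IsStationaryDist.dotProduct_pow_mulVec (hρ : IsStationaryDist G ρ) (h : S → ℝ) (t : ℕ) :
    ρ ⬝ᵥ (G ^ t *ᵥ h) = ρ ⬝ᵥ h := by
  induction t with
  | zero => simp
  | succ t ih => rw [pow_succ', ← Matrix.mulVec_mulVec, hρ.dotProduct_mulVec, ih]

/-- Geometric ergodicity of a mixing stochastic matrix. -/
theorem IsMixing.exists_geometric_bound (hG : IsMixing G) (hρ : IsStationaryDist G ρ)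
    (h : S → ℝ) : ∃ (C r : ℝ), 0 ≤ r ∧ r < 1 ∧
      ∀ (t : ℕ) (u : S), |(G ^ t *ᵥ h) u - ρ ⬝ᵥ h| ≤ C * r ^ t := by
  obtain ⟨N, z, hN, hpos⟩ := hG.exists_pos
  have hst : ∀ t, G ^ t ∈ Matrix.rowStochastic ℝ S := fun t => pow_mem hG.mem_rowStochastic t
  -- The cap 1/2 keeps 1 - ε positive and bounds by 2 the loss from replacing (1 - ε)^q by (1 -
  -- ε)^(q + 1).
  obtain ⟨ε, hε0, hε1, hε⟩ : ∃ ε : ℝ, 0 < ε ∧ ε ≤ 1 / 2 ∧ ∀ u, ε ≤ (G ^ N) u z := by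
    have : Nonempty S := ⟨z⟩
    obtain ⟨u₀, hu₀⟩ := Finite.exists_min fun u => (G ^ N) u z
    exact ⟨min ((G ^ N) u₀ z) (1 / 2), lt_min (hpos u₀) (by norm_num), min_le_right _ _,
      fun u => (min_le_left _ _).trans (hu₀ u)⟩
  obtain ⟨B, hB⟩ : ∃ B, ∀ u, |h u| ≤ B :=
    ⟨∑ u, |h u|, fun u => Finset.single_le_sum (f := fun u => |h u|) (fun _ _ => abs_nonneg _)
      (Finset.mem_univ u)⟩
  have hB0 : 0 ≤ B := (abs_nonneg _).trans (hB z)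
  -- The range shrinks by 1 - ε every `N` steps; `j` is the remainder of the time modulo `N`.
  have hrange : ∀ q j : ℕ, ∃ m M : ℝ, M - m = (1 - ε) ^ q * (2 * B) ∧
      ∀ u, (G ^ (N * q + j) *ᵥ h) u ∈ Set.Icc m M := by
    intro q j
    induction q with
    | zero =>
      refine ⟨-B, B, by ring, fun u => ?_⟩
      have := hst j
      rw [Matrix.mem_rowStochastic_iff_sum] at this
      simpa using mulVec_mem_Icc this.1 this.2 (fun v => abs_le.1 (hB v)) u
    | succ q ih =>
      obtain ⟨m, M, hmM, hmem⟩ := ih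
      have := hst N
      rw [Matrix.mem_rowStochastic_iff_sum] at this
      have hcontr := mulVec_mem_Icc_of_le this.1 this.2 hε hmem
      set w := (G ^ (N * q + j) *ᵥ h) z
      refine ⟨ε * w + (1 - ε) * m, ε * w + (1 - ε) * M, ?_, fun u => ?_⟩
      · rw [pow_succ]; linear_combination (1 - ε) * hmM
      · rw [show N * (q + 1) + j = N + (N * q + j) by ring, pow_add, ← Matrix.mulVec_mulVec]
        exact hcontr u
  set r : ℝ := (1 - ε) ^ ((N : ℝ)⁻¹) with hr
  have hr0 : 0 ≤ r := Real.rpow_nonneg (by linarith) _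
  have hr1 : r < 1 := Real.rpow_lt_one (by linarith) (by linarith) (by positivity)
  have hrN : r ^ N = 1 - ε := Real.rpow_inv_natCast_pow (by linarith) hN.ne'
  -- The initial range has length 2B, and rounding t / N costs another factor 2. By stationarity the
  -- limit ρ ⬝ᵥ h lies in the same shrinking interval as the values of G^t h.
  refine ⟨4 * B, r, hr0, hr1, fun t u => ?_⟩
  obtain ⟨m, M, hmM, hmem⟩ := hrange (t / N) (t % N)
  rw [Nat.div_add_mod] at hmem
  have h1 := hρ.dotProduct_mem_Icc hmem
  rw [hρ.dotProduct_pow_mulVec] at h1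
  have h2 := hmem u
  have h3 : (1 - ε) ^ (t / N) ≤ 2 * r ^ t := by
    have h4 : (1 - ε) ^ (t / N + 1) ≤ r ^ t := by
      rw [← hrN, ← pow_mul]
      exact pow_le_pow_of_le_one hr0 hr1.le (Nat.lt_mul_div_succ t hN).le
    have h5 : 0 ≤ (1 - ε) ^ (t / N) := pow_nonneg (by linarith) _
    rw [pow_succ] at h4
    nlinarith
  have h6 : |(G ^ t *ᵥ h) u - ρ ⬝ᵥ h| ≤ M - m := by
    rw [abs_le]; constructor <;> linarith [h1.1, h1.2, h2.1, h2.2]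
  refine h6.trans ?_
  rw [hmM]
  nlinarith

theorem IsMixing.summable_abs (hG : IsMixing G) (hρ : IsStationaryDist G ρ) (h : S → ℝ) (u : S) :
    Summable fun t : ℕ => |(G ^ t *ᵥ h) u - ρ ⬝ᵥ h| := by
  obtain ⟨C, r, hr0, hr1, hb⟩ := hG.exists_geometric_bound hρ h
  exact Summable.of_nonneg_of_le (fun _ => abs_nonneg _) (fun t => hb t u)
    ((summable_geometric_of_lt_one hr0 hr1).mul_left C)

/-- The solution `∑ t, G ^ t h` of the Poisson equation. -/
noncomputable def poissonSol (G : Matrix S S ℝ) (h : S → ℝ) (u : S) : ℝ := ∑' t : ℕ, (G ^ t *ᵥ h) u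

theorem IsMixing.summable (hG : IsMixing G) (hρ : IsStationaryDist G ρ) {h : S → ℝ}
    (hh : ρ ⬝ᵥ h = 0) (u : S) : Summable fun t : ℕ => (G ^ t *ᵥ h) u := by
  have := (hG.summable_abs hρ h u).of_abs
  simpa [hh] using this

/-- The Poisson equation. -/
theorem IsMixing.poissonSol_sub (hG : IsMixing G) (hρ : IsStationaryDist G ρ) {h : S → ℝ}
    (hh : ρ ⬝ᵥ h = 0) (u : S) :
    poissonSol G h u - (G *ᵥ poissonSol G h) u = h u := by
  have h1 : (G *ᵥ poissonSol G h) u = ∑' t : ℕ, (G ^ (t + 1) *ᵥ h) u := by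
    change ∑ v, G u v * ∑' t : ℕ, (G ^ t *ᵥ h) v = _
    simp_rw [← tsum_mul_left]
    rw [← Summable.tsum_finsetSum fun v _ => (hG.summable hρ hh v).mul_left _]
    refine tsum_congr fun t => ?_
    have : (G ^ (t + 1) *ᵥ h) u = (G *ᵥ (G ^ t *ᵥ h)) u := by
      rw [pow_succ', Matrix.mulVec_mulVec]
    exact this.symm
  rw [h1, poissonSol, (hG.summable hρ hh u).tsum_eq_zero_add]
  simp

end Mixing

/-! ### Ergodic matrices are mixing -/

theorem mul_apply_pos {S : Type*} [Fintype S] {A B : Matrix S S ℝ} (hA : ∀ u v, 0 ≤ A u v)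
    (hB : ∀ u v, 0 ≤ B u v) {u v w : S} (h1 : 0 < A u v) (h2 : 0 < B v w) : 0 < (A * B) u w :=
  (mul_pos h1 h2).trans_le <| Finset.single_le_sum (f := fun v => A u v * B v w)
    (fun v _ => mul_nonneg (hA u v) (hB v w)) (Finset.mem_univ v)

/-- Some power of an ergodic transition matrix is positive. -/
theorem IsErgodicTransition.exists_pow_pos {Λ : Type*} [Fintype Λ] [DecidableEq Λ]
    {P : Matrix Λ Λ ℝ} (hP : IsErgodicTransition P) : ∃ N, ∀ r s, 0 < (P ^ N) r s := by
  have hnn := hP.irreducible.nonneg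
  have hpow : ∀ k r s, 0 ≤ (P ^ k) r s := fun k => Matrix.pow_apply_nonneg hnn k
  have hirr := (Matrix.isIrreducible_iff_exists_pow_pos hnn).1 hP.irreducible
  have hreturn : ∀ r, ∃ n, ∀ m ≥ n, 0 < (P ^ m) r r := by
    intro r
    -- Return times are closed under addition and have gcd 1, so they include every sufficiently
    -- large integer.
    set s : Set ℕ := {n | 1 ≤ n ∧ 0 < (P ^ n) r r}
    have hs : Nat.setGcd s = 1 := hP.aperiodic r _ fun n h1 h2 => Nat.setGcd_dvd_of_mem ⟨h1, h2⟩
    obtain ⟨n, hn⟩ := Nat.exists_mem_closure_of_ge s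
    refine ⟨n, fun m hm => ?_⟩
    have := hn m hm (by simp [hs])
    refine AddSubmonoid.closure_induction (motive := fun m _ => 0 < (P ^ m) r r)
      (fun k hk => hk.2) (by simp) (fun a b _ _ ha hb => ?_) this
    rw [pow_add]
    exact mul_apply_pos (hpow a) (hpow b) ha hb
  choose n hn using hreturn
  choose k _ hk using hirr
  refine ⟨∑ r, n r + ∑ r, ∑ s, k r s, fun r s => ?_⟩
  have h1 : n r ≤ ∑ r, n r := Finset.single_le_sum (fun _ _ => Nat.zero_le _) (Finset.mem_univ r)
  have h2 : k r s ≤ ∑ r, ∑ s, k r s :=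
    (Finset.single_le_sum (f := fun s => k r s) (fun _ _ => Nat.zero_le _)
      (Finset.mem_univ s)).trans
    (Finset.single_le_sum (f := fun r => ∑ s, k r s) (fun _ _ => Nat.zero_le _)
      (Finset.mem_univ r))
  rw [show ∑ r, n r + ∑ r, ∑ s, k r s = (∑ r, n r + ∑ r, ∑ s, k r s - k r s) + k r s by omega,
    pow_add]
  exact mul_apply_pos (hpow _) (hpow _) (hn r _ (by omega)) (hk r s)

/-! ### Additive functionals of finite Markov chains -/

section Chain

variable {S Ω : Type*} [Fintype S] [MeasurableSpace S] [MeasurableSingletonClass S]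
  [MeasurableSpace Ω] {μ : Measure Ω} {ν : S → ℝ} {G : Matrix S S ℝ} {Z : ℕ → Ω → S}

/-- The path `p 0, …, p n`, continued constantly. -/
def extendPath {n : ℕ} (p : Fin (n + 1) → S) (k : ℕ) : S := p ⟨min k n, by omega⟩

-- Functionals of a finite history factor through the finite set of paths. Measurability,
-- integrability and the evaluation of integrals as finite sums all come from this.
omit [Fintype S] [MeasurableSpace S] [MeasurableSingletonClass S] in
theorem dependsOn_eq_extendPath {E : Type*} {F : (ℕ → S) → E} {n : ℕ}
    (hF : DependsOn F (Set.Iic n)) (c : ℕ → S) :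
    F c = F (extendPath fun i : Fin (n + 1) => c i) :=
  hF fun k hk => by simp [extendPath, min_eq_left (Set.mem_Iic.1 hk)]

omit [Fintype S] [MeasurableSingletonClass S] in
theorem measurable_path (hZ : ∀ n, Measurable (Z n)) (n : ℕ) :
    Measurable fun (ω : Ω) (i : Fin (n + 1)) => Z i ω :=
  measurable_pi_lambda _ fun i => hZ i

theorem measurable_of_dependsOn (hZ : ∀ n, Measurable (Z n)) {E : Type*} [MeasurableSpace E]
    {F : (ℕ → S) → E} {n : ℕ} (hF : DependsOn F (Set.Iic n)) :
    Measurable fun ω => F fun k => Z k ω := by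
  have : (fun ω => F fun k => Z k ω) =
      (fun p : Fin (n + 1) → S => F (extendPath p)) ∘ fun ω i => Z i ω :=
    funext fun ω => dependsOn_eq_extendPath hF _
  rw [this]
  exact Measurable.of_discrete.comp (measurable_path hZ n)

variable [IsProbabilityMeasure μ]

theorem integrable_of_dependsOn (hZ : ∀ n, Measurable (Z n)) {E : Type*} [NormedAddCommGroup E]
    {F : (ℕ → S) → E} {n : ℕ} (hF : DependsOn F (Set.Iic n)) :
    Integrable (fun ω => F fun k => Z k ω) μ := by
  have : (fun ω => F fun k => Z k ω) =
      (fun p : Fin (n + 1) → S => F (extendPath p)) ∘ fun ω i => Z i ω :=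
    funext fun ω => dependsOn_eq_extendPath hF _
  rw [this]
  have := Measure.isProbabilityMeasure_map (μ := μ) (measurable_path hZ n).aemeasurable
  exact Integrable.of_finite.comp_measurable (measurable_path hZ n)

theorem integral_comp_eq_sum {T E : Type*} [Fintype T] [MeasurableSpace T]
    [MeasurableSingletonClass T] [NormedAddCommGroup E] [NormedSpace ℝ E] [CompleteSpace E]
    {X : Ω → T} (hX : Measurable X)
    (f : T → E) : ∫ ω, f (X ω) ∂μ = ∑ x, μ.real {ω | X ω = x} • f x := by
  have := Measure.isProbabilityMeasure_map (μ := μ) hX.aemeasurable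
  rw [← integral_map hX.aemeasurable (Integrable.of_finite (μ := μ.map X)).aestronglyMeasurable,
    integral_fintype Integrable.of_finite]
  refine Finset.sum_congr rfl fun x _ => ?_
  rw [map_measureReal_apply hX (measurableSet_singleton x)]
  rfl

/-- The Markov property, integrated against functions of the past. -/
theorem IsMarkovChain.integral_step (h : IsMarkovChain μ ν G Z) {𝕜 : Type*} [RCLike 𝕜]
    {ψ : (ℕ → S) → 𝕜} {n : ℕ} (hψ : DependsOn ψ (Set.Iic n)) (H : S → S → 𝕜) :
    ∫ ω, (ψ fun k => Z k ω) * H (Z n ω) (Z (n + 1) ω) ∂μ =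
      ∫ ω, (ψ fun k => Z k ω) * ∑ v, (G (Z n ω) v : 𝕜) * H (Z n ω) v ∂μ := by
  have hm := measurable_path h.measurable n
  have h1 := integral_comp_eq_sum (μ := μ) (hm.prodMk (h.measurable (n + 1)))
    (fun q : (Fin (n + 1) → S) × S => ψ (extendPath q.1) * H (q.1 (Fin.last n)) q.2)
  have h2 := integral_comp_eq_sum (μ := μ) hm
    (fun p : Fin (n + 1) → S => ψ (extendPath p) *
      ∑ v, (G (p (Fin.last n)) v : 𝕜) * H (p (Fin.last n)) v)
  have h0 : ∀ ω, ψ (extendPath fun i : Fin (n + 1) => Z i ω) = ψ fun k => Z k ω := fun ω =>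
    (dependsOn_eq_extendPath hψ fun k => Z k ω).symm
  simp only [Fin.val_last, h0] at h1 h2
  rw [h1, h2, Fintype.sum_prod_type]
  refine Finset.sum_congr rfl fun p _ => ?_
  rw [Finset.mul_sum, Finset.smul_sum]
  refine Finset.sum_congr rfl fun v _ => ?_
  -- The Markov property is used along the path `p` followed by `v`; the values beyond time n + 1
  -- play no role.
  have h3 := h.markov n fun k => if hk : k < n + 1 then p ⟨k, hk⟩ else v
  have h4 : {ω | ∀ k ≤ n + 1, Z k ω = if hk : k < n + 1 then p ⟨k, hk⟩ else v} =
      {ω | ((fun i : Fin (n + 1) => Z i ω), Z (n + 1) ω) = (p, v)} := by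
    ext ω
    simp only [Set.mem_ofPred_eq, Prod.mk.injEq, funext_iff]
    refine ⟨fun hω => ⟨fun i => by simpa [i.2] using hω i (by omega),
      by simpa using hω (n + 1) le_rfl⟩, fun hω k hk => ?_⟩
    rcases hk.lt_or_eq with hk | rfl
    · simpa [hk] using hω.1 ⟨k, hk⟩
    · simpa using hω.2
  have h5 : {ω | ∀ k ≤ n, Z k ω = if hk : k < n + 1 then p ⟨k, hk⟩ else v} =
      {ω | (fun i : Fin (n + 1) => Z i ω) = p} := by
    ext ω
    simp only [Set.mem_ofPred_eq, funext_iff]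
    refine ⟨fun hω i => by simpa [i.2] using hω i (by omega), fun hω k hk => ?_⟩
    simpa [Nat.lt_succ_iff.2 hk] using hω ⟨k, Nat.lt_succ_iff.2 hk⟩
  rw [h4, h5] at h3
  rw [h3]
  simp only [Nat.lt_succ_self, dite_true, lt_irrefl, dite_false, RCLike.real_smul_eq_coe_mul,
    RCLike.ofReal_mul]
  change _ * ((G (p (Fin.last n)) v : ℝ) : 𝕜) * _ = _
  ring

/-- The additive functional `∑_{k < n} D (c k) (c (k + 1))`. -/
def addFun (D : S → S → ℝ) (n : ℕ) (c : ℕ → S) : ℝ := ∑ k ∈ Finset.range n, D (c k) (c (k + 1))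

omit [Fintype S] [MeasurableSpace S] [MeasurableSingletonClass S] in
theorem dependsOn_addFun (D : S → S → ℝ) (n : ℕ) : DependsOn (addFun D n) (Set.Iic n) := by
  intro c d h
  refine Finset.sum_congr rfl fun k hk => ?_
  have := Finset.mem_range.1 hk
  rw [h k (Set.mem_Iic.2 (by omega)), h (k + 1) (Set.mem_Iic.2 (by omega))]

omit [Fintype S] [MeasurableSpace S] [MeasurableSingletonClass S] in
theorem addFun_succ (D : S → S → ℝ) (n : ℕ) (c : ℕ → S) :
    addFun D (n + 1) c = addFun D n c + D (c n) (c (n + 1)) := Finset.sum_range_succ _ _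

omit [Fintype S] [MeasurableSpace S] [MeasurableSingletonClass S] in
theorem dependsOn_mono_Iic {E : Type*} {F : (ℕ → S) → E} {m n : ℕ}
    (hF : DependsOn F (Set.Iic m)) (hmn : m ≤ n) : DependsOn F (Set.Iic n) :=
  fun _ _ h => hF fun k hk => h k (hk.trans hmn)

/-! ### Moments of the martingale part -/

variable {D : S → S → ℝ} {b : S → ℝ} {σ2 : ℝ}

/-- The increments `D` are martingale increments for the chain with matrix `G`, and `b` solves the
Poisson equation for their conditional variances, whose mean is `σ2`. -/
structure IsMartingaleIncrement (G : Matrix S S ℝ) (D : S → S → ℝ) (b : S → ℝ) (σ2 : ℝ) :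
    Prop where
  sum_eq_one : ∀ u, ∑ v, G u v = 1
  nonneg : ∀ u v, 0 ≤ G u v
  mean : ∀ u, ∑ v, G u v * D u v = 0
  sq : ∀ u, ∑ v, G u v * (D u v ^ 2 + b v) = σ2 + b u

theorem IsMarkovChain.integral_addFun (h : IsMarkovChain μ ν G Z)
    (hD : IsMartingaleIncrement G D b σ2) (n : ℕ) :
    ∫ ω, addFun D n (fun k => Z k ω) ∂μ = 0 := by
  induction n with
  | zero => simp [addFun]
  | succ n ih =>
    simp_rw [addFun_succ]
    rw [integral_add, ih]
    · have := h.integral_step (𝕜 := ℝ) (ψ := fun _ => 1) (n := n) (fun _ _ _ => rfl) D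
      simp only [one_mul, RCLike.ofReal_real_eq_id, id] at this
      simp [this, hD.mean]
    · exact integrable_of_dependsOn h.measurable (dependsOn_addFun D n)
    · exact integrable_of_dependsOn h.measurable (F := fun c => D (c n) (c (n + 1))) (n := n + 1)
        fun c d hcd => by simp only [hcd n (by simp), hcd (n + 1) (by simp)]

/-- The cross term vanishes because the increments are conditionally centred. The corrector `b`
absorbs the dependence of the conditional variance on the state, so the identity is exact for every
initial law. -/
theorem IsMarkovChain.integral_addFun_sq (h : IsMarkovChain μ ν G Z)
    (hD : IsMartingaleIncrement G D b σ2) (n : ℕ) :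
    ∫ ω, addFun D n (fun k => Z k ω) ^ 2 ∂μ + ∫ ω, b (Z n ω) ∂μ =
      n * σ2 + ∫ ω, b (Z 0 ω) ∂μ := by
  induction n with
  | zero => simp [addFun]
  | succ n ih =>
    have hb : ∀ n, Integrable (fun ω => b (Z n ω)) μ := fun n =>
      integrable_of_dependsOn h.measurable (F := fun c => b (c n)) (n := n)
        fun c d hcd => by simp only [hcd n (by simp)]
    have hS : ∀ n, Integrable (fun ω => addFun D n (fun k => Z k ω) ^ 2) μ := fun n =>
      integrable_of_dependsOn h.measurable (F := fun c => addFun D n c ^ 2) (n := n)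
        fun c d hcd => by simp only [dependsOn_addFun D n hcd]
    have h1 := h.integral_step (𝕜 := ℝ) (dependsOn_addFun D n) D
    have h2 := h.integral_step (𝕜 := ℝ) (ψ := fun _ => 1) (n := n) (fun _ _ _ => rfl)
      (fun u v => D u v ^ 2 + b v)
    simp only [one_mul, RCLike.ofReal_real_eq_id, id, hD.mean, hD.sq, mul_zero,
      integral_zero] at h1 h2
    have i1 : Integrable (fun ω => addFun D n (fun k => Z k ω) * D (Z n ω) (Z (n + 1) ω)) μ :=
      integrable_of_dependsOn h.measurable
        (F := fun c => addFun D n c * D (c n) (c (n + 1))) (n := n + 1)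
        fun c d hcd => by
          simp only [hcd n (by simp), hcd (n + 1) (by simp),
            dependsOn_mono_Iic (dependsOn_addFun D n) (Nat.le_succ n) hcd]
    have i2 : Integrable (fun ω => D (Z n ω) (Z (n + 1) ω) ^ 2 + b (Z (n + 1) ω)) μ :=
      integrable_of_dependsOn h.measurable
        (F := fun c => D (c n) (c (n + 1)) ^ 2 + b (c (n + 1))) (n := n + 1)
        fun c d hcd => by simp only [hcd n (by simp), hcd (n + 1) (by simp)]
    rw [← integral_add (hS _) (hb _)]
    have h3 : ∀ ω, addFun D (n + 1) (fun k => Z k ω) ^ 2 + b (Z (n + 1) ω) =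
        addFun D n (fun k => Z k ω) ^ 2 +
          2 * (addFun D n (fun k => Z k ω) * D (Z n ω) (Z (n + 1) ω)) +
          (D (Z n ω) (Z (n + 1) ω) ^ 2 + b (Z (n + 1) ω)) := fun ω => by
      rw [addFun_succ]; ring
    simp_rw [h3]
    have i3 : Integrable (fun ω => addFun D n (fun k => Z k ω) ^ 2 +
      2 * (addFun D n (fun k => Z k ω) * D (Z n ω) (Z (n + 1) ω))) μ := (hS n).add (i1.const_mul 2)
    rw [integral_add i3 i2, integral_add (hS n) (i1.const_mul 2),
      integral_const_mul, h1, h2, integral_add (integrable_const _) (hb n)]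
    simp only [integral_const, probReal_univ, smul_eq_mul]
    push_cast
    linarith

/-! ### Characteristic functions of the martingale -/

/-- The one-step error in the approximation of characteristic functions. -/
noncomputable def charError (G : Matrix S S ℝ) (D : S → S → ℝ) (b : S → ℝ) (σ2 : ℝ) (θ : ℝ) (u : S) : ℂ :=
  ∑ v, (G u v : ℂ) * (Complex.exp (D u v * θ * Complex.I) * (1 - θ ^ 2 * b v / 2)) -
    Complex.exp (-(σ2 * θ ^ 2 / 2)) * (1 - θ ^ 2 * b u / 2)

/-- Conditioning on the past turns one step of the weighted characteristic function into
multiplication by λ = exp(-σ²θ²/2), plus a term bounded by `charError`. Since |λ| ≤ 1, the errors of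
the n steps merely add up. -/
theorem IsMarkovChain.norm_integral_exp_addFun_le (h : IsMarkovChain μ ν G Z) (hσ : 0 ≤ σ2)
    (θ : ℝ) (n : ℕ) :
    ‖∫ ω, Complex.exp (addFun D n (fun k => Z k ω) * θ * Complex.I) *
        (1 - θ ^ 2 * b (Z n ω) / 2) ∂μ -
      Complex.exp (-(σ2 * θ ^ 2 / 2)) ^ n * ∫ ω, (1 - (θ ^ 2 * b (Z 0 ω) / 2 : ℂ)) ∂μ‖ ≤
      n * ∑ u, ‖charError G D b σ2 θ u‖ := by
  induction n with
  | zero => simp [addFun]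
  | succ n ih =>
    set lam := Complex.exp (-(σ2 * θ ^ 2 / 2)) with hlam
    have hlam1 : ‖lam‖ ≤ 1 := by
      rw [hlam, Complex.norm_exp]
      have : (-(σ2 * θ ^ 2 / 2) : ℂ).re = -(σ2 * θ ^ 2 / 2) := by norm_cast
      rw [this, Real.exp_le_one_iff]
      have := mul_nonneg hσ (sq_nonneg θ)
      linarith
    have hψ : DependsOn (fun c => Complex.exp (addFun D n c * θ * Complex.I)) (Set.Iic n) :=
      fun c d hcd => by simp only [dependsOn_addFun D n hcd]
    have h1 := h.integral_step hψ
      fun u v => Complex.exp (D u v * θ * Complex.I) * (1 - θ ^ 2 * b v / 2)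
    have h2 : ∀ ω, Complex.exp (addFun D (n + 1) (fun k => Z k ω) * θ * Complex.I) *
        (1 - θ ^ 2 * b (Z (n + 1) ω) / 2) =
        Complex.exp (addFun D n (fun k => Z k ω) * θ * Complex.I) *
          (Complex.exp (D (Z n ω) (Z (n + 1) ω) * θ * Complex.I) *
            (1 - θ ^ 2 * b (Z (n + 1) ω) / 2)) := fun ω => by
      rw [addFun_succ, ← mul_assoc, ← Complex.exp_add]
      push_cast
      ring_nf
    simp_rw [h2]
    rw [h1]
    have h3 : ∀ ω, Complex.exp (addFun D n (fun k => Z k ω) * θ * Complex.I) *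
        ∑ v, ((G (Z n ω) v : ℝ) : ℂ) *
          (Complex.exp (D (Z n ω) v * θ * Complex.I) * (1 - θ ^ 2 * b v / 2)) =
        Complex.exp (addFun D n (fun k => Z k ω) * θ * Complex.I) *
          charError G D b σ2 θ (Z n ω) +
        lam * (Complex.exp (addFun D n (fun k => Z k ω) * θ * Complex.I) *
          (1 - θ ^ 2 * b (Z n ω) / 2)) := fun ω => by
      rw [charError]; ring
    have i1 : Integrable (fun ω => Complex.exp (addFun D n (fun k => Z k ω) * θ * Complex.I) *
          charError G D b σ2 θ (Z n ω)) μ :=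
      integrable_of_dependsOn h.measurable (n := n)
        (F := fun c => Complex.exp (addFun D n c * θ * Complex.I) * charError G D b σ2 θ (c n))
        fun c d hcd => by simp only [dependsOn_addFun D n hcd, hcd n (by simp)]
    have i2 : Integrable (fun ω => Complex.exp (addFun D n (fun k => Z k ω) * θ * Complex.I) *
          (1 - (θ ^ 2 * b (Z n ω) / 2 : ℂ))) μ :=
      integrable_of_dependsOn h.measurable (n := n)
        (F := fun c => Complex.exp (addFun D n c * θ * Complex.I) *
          (1 - (θ ^ 2 * b (c n) / 2 : ℂ)))
        fun c d hcd => by simp only [dependsOn_addFun D n hcd, hcd n (by simp)]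
    simp only [Complex.coe_algebraMap, h3]
    rw [integral_add i1 (i2.const_mul _), integral_const_mul]
    have h4 : ‖∫ ω, Complex.exp (addFun D n (fun k => Z k ω) * θ * Complex.I) *
          charError G D b σ2 θ (Z n ω) ∂μ‖ ≤ ∑ u, ‖charError G D b σ2 θ u‖ := by
      have := norm_integral_le_of_norm_le_const (μ := μ)
        (f := fun ω => Complex.exp (addFun D n (fun k => Z k ω) * θ * Complex.I) *
          charError G D b σ2 θ (Z n ω)) (C := ∑ u, ‖charError G D b σ2 θ u‖)
        (Eventually.of_forall fun ω => by
          rw [norm_mul, ← Complex.ofReal_mul, Complex.norm_exp_ofReal_mul_I, one_mul]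
          exact Finset.single_le_sum (f := fun u => ‖charError G D b σ2 θ u‖)
            (fun _ _ => norm_nonneg _) (Finset.mem_univ _))
      simpa using this
    set A := ∫ ω, Complex.exp (addFun D n (fun k => Z k ω) * θ * Complex.I) *
          (1 - (θ ^ 2 * b (Z n ω) / 2 : ℂ)) ∂μ
    set A₀ := ∫ ω, (1 - (θ ^ 2 * b (Z 0 ω) / 2 : ℂ)) ∂μ
    set R := ∫ ω, Complex.exp (addFun D n (fun k => Z k ω) * θ * Complex.I) *
          charError G D b σ2 θ (Z n ω) ∂μ
    calc ‖R + lam * A - lam ^ (n + 1) * A₀‖ = ‖R + lam * (A - lam ^ n * A₀)‖ := by ring_nf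
      _ ≤ ‖R‖ + ‖lam‖ * ‖A - lam ^ n * A₀‖ := by
        rw [← norm_mul]; exact norm_add_le _ _
      _ ≤ ∑ u, ‖charError G D b σ2 θ u‖ + 1 * (n * ∑ u, ‖charError G D b σ2 θ u‖) := by
        gcongr
      _ = _ := by push_cast; ring

-- The Taylor terms of order 0, 1 and 2 cancel by `sum_eq_one`, `mean` and `sq` respectively; the
-- weight 1 - θ²b/2 is chosen for the second-order cancellation.
omit [MeasurableSpace S] [MeasurableSingletonClass S] in
theorem charError_isBigO (hD : IsMartingaleIncrement G D b σ2) (u : S) :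
    (fun θ => charError G D b σ2 θ u) =O[𝓝 0] fun θ : ℝ => θ ^ 3 := by
  have hE : ∀ d : ℝ, (fun θ : ℝ => Complex.exp (d * θ * Complex.I) -
      (1 + d * θ * Complex.I - d ^ 2 * θ ^ 2 / 2)) =O[𝓝 0] fun θ : ℝ => θ ^ 3 := by
    intro d
    have h1 := (Complex.exp_sub_sum_range_isBigO_pow 3).comp_tendsto
      (k := fun θ : ℝ => (d * θ * Complex.I : ℂ)) (l' := 𝓝 0)
      (Continuous.tendsto' (by fun_prop) _ _ (by simp))
    refine (h1.congr_left fun θ => ?_).trans ?_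
    · simp only [Function.comp_apply, Finset.sum_range_succ, Finset.sum_range_zero]
      have : (d * θ * Complex.I : ℂ) ^ 2 = -(d ^ 2 * θ ^ 2) := by
        rw [mul_pow, Complex.I_sq]; ring
      rw [this]
      norm_num
      ring
    · refine Asymptotics.IsBigO.of_bound (|d| ^ 3) (Eventually.of_forall fun θ => ?_)
      simp [mul_pow]
  have hR : (fun θ : ℝ => Complex.exp (-(σ2 * θ ^ 2 / 2)) - (1 - σ2 * θ ^ 2 / 2)) =O[𝓝 0]
      fun θ : ℝ => θ ^ 3 := by
    have h1 := (Complex.exp_sub_sum_range_isBigO_pow 2).comp_tendsto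
      (k := fun θ : ℝ => (-(σ2 * θ ^ 2 / 2) : ℂ)) (l' := 𝓝 0)
      (Continuous.tendsto' (by fun_prop) _ _ (by simp))
    refine (h1.congr_left fun θ => ?_).trans ?_
    · simp [Finset.sum_range_succ]
      ring
    · have h2 : (fun θ : ℝ => θ ^ 4) =O[𝓝 0] fun θ : ℝ => θ ^ 3 :=
        (Asymptotics.isLittleO_pow_pow (by norm_num)).isBigO
      refine Asymptotics.IsBigO.trans (Asymptotics.IsBigO.of_bound (|σ2| ^ 2)
        (Eventually.of_forall fun θ => ?_)) h2
      simp only [Function.comp_apply, norm_pow, norm_neg, norm_div, norm_mul, Complex.norm_real,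
        Real.norm_eq_abs, Complex.norm_ofNat]
      rw [div_pow, mul_pow, ← pow_mul]
      have : 0 ≤ |σ2| ^ 2 * |θ| ^ 4 := by positivity
      norm_num at this ⊢
      linarith
  have hO1 : ∀ f : ℝ → ℂ, Continuous f → f =O[𝓝 0] fun _ : ℝ => (1 : ℝ) := fun f hf =>
    hf.continuousAt.isBigO_one ℝ
  have hmul : ∀ e f : ℝ → ℂ, e =O[𝓝 0] (fun θ : ℝ => θ ^ 3) → Continuous f →
      (fun θ => e θ * f θ) =O[𝓝 0] fun θ : ℝ => θ ^ 3 := fun e f he hf => by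
    simpa using he.mul (hO1 f hf)
  have hcube : (fun θ : ℝ => (θ ^ 3 : ℂ)) =O[𝓝 0] fun θ : ℝ => θ ^ 3 :=
    Asymptotics.IsBigO.of_bound 1 (Eventually.of_forall fun θ => by simp)
  have hdecomp : ∀ θ : ℝ, charError G D b σ2 θ u =
      ∑ v, (Complex.exp (D u v * θ * Complex.I) -
        (1 + D u v * θ * Complex.I - (D u v : ℂ) ^ 2 * θ ^ 2 / 2)) *
          (G u v * (1 - θ ^ 2 * b v / 2)) -
      (Complex.exp (-(σ2 * θ ^ 2 / 2)) - (1 - σ2 * θ ^ 2 / 2)) * (1 - θ ^ 2 * b u / 2) +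
      θ ^ 3 * (∑ v, G u v * (-Complex.I * D u v * b v / 2 + θ * (D u v : ℂ) ^ 2 * b v / 4) -
        θ * σ2 * b u / 4) := by
    intro θ
    have e0 : ∑ v, (G u v : ℂ) = 1 := by exact_mod_cast hD.sum_eq_one u
    have e1 : ∑ v, (G u v : ℂ) * D u v = 0 := by exact_mod_cast hD.mean u
    have e2 : ∑ v, (G u v : ℂ) * ((D u v : ℂ) ^ 2 + b v) = σ2 + b u := by
      exact_mod_cast hD.sq u
    have e3 : ∑ v, (Complex.exp (D u v * θ * Complex.I) -
        (1 + D u v * θ * Complex.I - (D u v : ℂ) ^ 2 * θ ^ 2 / 2)) *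
          (G u v * (1 - θ ^ 2 * b v / 2)) =
        ∑ v, (G u v : ℂ) * (Complex.exp (D u v * θ * Complex.I) * (1 - θ ^ 2 * b v / 2)) -
        (∑ v, (G u v : ℂ) + θ * Complex.I * ∑ v, (G u v : ℂ) * D u v -
          θ ^ 2 / 2 * ∑ v, (G u v : ℂ) * ((D u v : ℂ) ^ 2 + b v) +
          θ ^ 3 * ∑ v, G u v * (-Complex.I * D u v * b v / 2 + θ * (D u v : ℂ) ^ 2 * b v / 4)) := by
      simp only [Finset.mul_sum, ← Finset.sum_add_distrib, ← Finset.sum_sub_distrib]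
      exact Finset.sum_congr rfl fun v _ => by ring
    rw [e3, e0, e1, e2, charError]
    ring
  simp_rw [hdecomp]
  have p1 := Asymptotics.IsBigO.sum (s := Finset.univ) fun v _ =>
    hmul _ (fun θ : ℝ => (G u v * (1 - θ ^ 2 * b v / 2) : ℂ)) (hE (D u v)) (by fun_prop)
  have p2 := hmul _ (fun θ : ℝ => (1 - θ ^ 2 * b u / 2 : ℂ)) hR (by fun_prop)
  have p3 := hmul _ (fun θ : ℝ =>
    (∑ v, G u v * (-Complex.I * D u v * b v / 2 + θ * (D u v : ℂ) ^ 2 * b v / 4) -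
      θ * σ2 * b u / 4 : ℂ)) hcube (by fun_prop)
  exact ((p1.sub p2).add p3).congr_left fun θ => by simp only [Finset.sum_apply]

omit [MeasurableSpace S] [MeasurableSingletonClass S] in
theorem exists_abs_integral_le (b : S → ℝ) (Z : ℕ → Ω → S) : ∃ B, ∀ n, |∫ ω, b (Z n ω) ∂μ| ≤ B := by
  refine ⟨∑ u, |b u|, fun n => ?_⟩
  have := norm_integral_le_of_norm_le_const (μ := μ) (f := fun ω => b (Z n ω)) (C := ∑ u, |b u|)
    (Eventually.of_forall fun ω => Finset.single_le_sum (f := fun u => |b u|)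
      (fun _ _ => abs_nonneg _) (Finset.mem_univ _))
  simpa using this

/-- With θ = t/√n, the accumulated error is n · O(n^(-3/2)), the n-th power of the factor is exactly
exp(-σ²t²/2), and the weights 1 - θ²b/2 differ from 1 by O(1/n). -/
theorem IsMarkovChain.tendsto_integral_exp_addFun (h : IsMarkovChain μ ν G Z)
    (hD : IsMartingaleIncrement G D b σ2) (hσ : 0 ≤ σ2) (t : ℝ) :
    Tendsto (fun n : ℕ => ∫ ω, Complex.exp (addFun D n (fun k => Z k ω) * (t / √n : ℝ) *
      Complex.I) ∂μ) atTop (𝓝 (Complex.exp (-(σ2 * t ^ 2 / 2)))) := by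
  set θ : ℕ → ℝ := fun n => t / √n with hθ
  have hsqrt : Tendsto (fun n : ℕ => √(n : ℝ)) atTop atTop :=
    Real.tendsto_sqrt_atTop.comp tendsto_natCast_atTop_atTop
  have hθ0 : Tendsto θ atTop (𝓝 0) := hsqrt.const_div_atTop t
  have hθsq : Tendsto (fun n => θ n ^ 2) atTop (𝓝 0) := by simpa using hθ0.pow 2
  have herr : Tendsto (fun n : ℕ => (n : ℝ) * ∑ u, ‖charError G D b σ2 (θ n) u‖) atTop (𝓝 0) := by
    simp_rw [Finset.mul_sum]
    rw [← Finset.sum_const_zero (s := (Finset.univ : Finset S))]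
    refine tendsto_finsetSum _ fun u _ => ?_
    have h1 := ((charError_isBigO hD u).comp_tendsto hθ0).norm_left
    refine ((Asymptotics.isBigO_refl (fun n : ℕ => (n : ℝ)) atTop).mul h1).trans_tendsto ?_
    have h2 : Tendsto (fun n : ℕ => t ^ 3 / √n) atTop (𝓝 0) := hsqrt.const_div_atTop _
    refine h2.congr' ((eventually_gt_atTop 0).mono fun n hn => ?_)
    have hn' : (0 : ℝ) < n := by exact_mod_cast hn
    have h3 := Real.sq_sqrt hn'.le
    have h4 := Real.sqrt_pos.2 hn'
    simp only [Function.comp_apply, hθ]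
    field_simp
    rw [h3]
  obtain ⟨B, hB⟩ := exists_abs_integral_le (μ := μ) (fun u => |b u|) Z
  set A : ℕ → ℂ := fun n => ∫ ω, Complex.exp (addFun D n (fun k => Z k ω) * θ n * Complex.I) *
    (1 - (θ n) ^ 2 * b (Z n ω) / 2) ∂μ with hA
  set lam : ℕ → ℂ := fun n => Complex.exp (-(σ2 * (θ n) ^ 2 / 2)) ^ n with hlam
  set A₀ : ℕ → ℂ := fun n => ∫ ω, (1 - ((θ n) ^ 2 * b (Z 0 ω) / 2 : ℂ)) ∂μ with hA₀
  have hb : ∀ n, Integrable (fun ω => b (Z n ω)) μ := fun n =>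
    integrable_of_dependsOn h.measurable (F := fun c => b (c n)) (n := n)
      fun c d hcd => by simp only [hcd n (by simp)]
  have h1 : Tendsto (fun n => A n - lam n * A₀ n) atTop (𝓝 0) :=
    squeeze_zero_norm (fun n => h.norm_integral_exp_addFun_le hσ (θ n) n) herr
  have h2 : Tendsto lam atTop (𝓝 (Complex.exp (-(σ2 * t ^ 2 / 2)))) := by
    refine tendsto_const_nhds.congr' ((eventually_gt_atTop 0).mono fun n hn => ?_)
    have hn' : (0 : ℝ) < n := by exact_mod_cast hn
    simp only [hlam, hθ]
    rw [← Complex.exp_nat_mul]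
    congr 1
    have h3 := Real.sq_sqrt hn'.le
    norm_cast
    rw [div_pow, h3]
    field_simp
  have h3 : Tendsto A₀ atTop (𝓝 1) := by
    have h4 : ∀ n, A₀ n = ((1 - θ n ^ 2 * (∫ ω, b (Z 0 ω) ∂μ) / 2 : ℝ) : ℂ) := fun n => by
      have h5 : ∀ ω, (1 - ((θ n) ^ 2 * b (Z 0 ω) / 2 : ℂ)) =
        ((1 - θ n ^ 2 * b (Z 0 ω) / 2 : ℝ) : ℂ) := fun ω => by push_cast; ring
      simp only [hA₀, h5]
      rw [integral_complex_ofReal, integral_sub (integrable_const _) (((hb 0).const_mul _).div_const _),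
        integral_div, integral_const_mul]
      simp
    rw [funext h4]
    have h5 : Tendsto (fun n => 1 - θ n ^ 2 * (∫ ω, b (Z 0 ω) ∂μ) / 2) atTop (𝓝 1) := by
      simpa using ((hθsq.mul_const (∫ ω, b (Z 0 ω) ∂μ)).div_const 2).const_sub 1
    exact_mod_cast (Complex.continuous_ofReal.tendsto _).comp h5
  have h4 : Tendsto (fun n => (∫ ω, Complex.exp (addFun D n (fun k => Z k ω) * θ n *
      Complex.I) ∂μ) - A n) atTop (𝓝 0) := by
    refine squeeze_zero_norm (fun n => ?_) (by simpa using hθsq.mul_const (B / 2))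
    have i1 : Integrable (fun ω => Complex.exp (addFun D n (fun k => Z k ω) * θ n *
        Complex.I)) μ := integrable_of_dependsOn h.measurable (n := n)
      (F := fun c => Complex.exp (addFun D n c * θ n * Complex.I))
      fun c d hcd => by simp only [dependsOn_addFun D n hcd]
    have i2 : Integrable (fun ω => Complex.exp (addFun D n (fun k => Z k ω) * θ n *
        Complex.I) * (1 - ((θ n) ^ 2 * b (Z n ω) / 2 : ℂ))) μ :=
      integrable_of_dependsOn h.measurable (n := n)
      (F := fun c => Complex.exp (addFun D n c * θ n * Complex.I) *
        (1 - ((θ n) ^ 2 * b (c n) / 2 : ℂ)))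
      fun c d hcd => by simp only [dependsOn_addFun D n hcd, hcd n (by simp)]
    rw [hA, ← integral_sub i1 i2]
    refine (norm_integral_le_integral_norm _).trans ?_
    calc _ = ∫ ω, θ n ^ 2 / 2 * |b (Z n ω)| ∂μ := integral_congr_ae <| Eventually.of_forall fun ω => by
          have h6 : ∀ e x : ℂ, e - e * (1 - x) = e * x := fun e x => by ring
          simp only [h6]
          rw [norm_mul, ← Complex.ofReal_mul, Complex.norm_exp_ofReal_mul_I, one_mul]
          simp
          ring
      _ = θ n ^ 2 / 2 * ∫ ω, |b (Z n ω)| ∂μ := integral_const_mul _ _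
      _ ≤ θ n ^ 2 / 2 * B := by gcongr; exact (le_abs_self _).trans (hB n)
      _ = _ := by ring
  have h5 := (h4.add h1).add (h2.mul h3)
  rw [zero_add, zero_add, mul_one] at h5
  exact h5.congr fun n => by ring

/-! ### Transfer to sequences near the martingale -/

/-- The variance of a sequence at bounded distance from a martingale. -/
theorem IsMarkovChain.tendsto_variance_div (h : IsMarkovChain μ ν G Z)
    (hD : IsMartingaleIncrement G D b σ2) {Y : ℕ → Ω → ℝ} (hY : ∀ n, Measurable (Y n)) {C : ℝ}
    (hC : ∀ n ω, |Y n ω - addFun D n (fun k => Z k ω)| ≤ C) :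
    Tendsto (fun n : ℕ => variance (Y n) μ / n) atTop (𝓝 σ2) := by
  have hM : ∀ n, Measurable fun ω => addFun D n (fun k => Z k ω) := fun n =>
    measurable_of_dependsOn h.measurable (dependsOn_addFun D n)
  have iM : ∀ n, Integrable (fun ω => addFun D n (fun k => Z k ω)) μ := fun n =>
    integrable_of_dependsOn h.measurable (dependsOn_addFun D n)
  have iM2 : ∀ n, Integrable (fun ω => addFun D n (fun k => Z k ω) ^ 2) μ := fun n =>
    integrable_of_dependsOn h.measurable (F := fun c => addFun D n c ^ 2) (n := n)
      fun c d hcd => by simp only [dependsOn_addFun D n hcd]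
  obtain ⟨B, hB⟩ := exists_abs_integral_le (μ := μ) b Z
  have hC0 : 0 ≤ C := by
    have : Nonempty Ω := nonempty_of_isProbabilityMeasure μ
    exact (abs_nonneg _).trans (hC 0 (Classical.arbitrary Ω))
  set V : ℕ → ℝ := fun n => ∫ ω, addFun D n (fun k => Z k ω) ^ 2 ∂μ with hV
  have hsqrt : Tendsto (fun n : ℕ => √(n : ℝ)) atTop atTop :=
    Real.tendsto_sqrt_atTop.comp tendsto_natCast_atTop_atTop
  have hVlim : Tendsto (fun n : ℕ => V n / n) atTop (𝓝 σ2) := by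
    have h1 : Tendsto (fun n : ℕ => V n / n - σ2) atTop (𝓝 0) := by
      refine squeeze_zero_norm' ((eventually_gt_atTop 0).mono fun n hn => ?_)
        (tendsto_const_div_atTop_nhds_zero_nat (2 * B))
      have hn' : (0 : ℝ) < n := by exact_mod_cast hn
      have h2 := h.integral_addFun_sq hD n
      have h3 : V n / n - σ2 = (∫ ω, b (Z 0 ω) ∂μ - ∫ ω, b (Z n ω) ∂μ) / n := by
        simp only [hV]
        field_simp
        linarith
      rw [h3, norm_div, Real.norm_of_nonneg hn'.le, Real.norm_eq_abs]
      gcongr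
      have := abs_sub (∫ ω, b (Z 0 ω) ∂μ) (∫ ω, b (Z n ω) ∂μ)
      linarith [hB 0, hB n]
    simpa using h1.add_const σ2
  have hbound : ∀ n : ℕ, 0 < n → |variance (Y n) μ - V n| ≤ C * (V n / √n + √n) + 2 * C ^ 2 := by
    intro n hn
    have hs : 0 < √(n : ℝ) := Real.sqrt_pos.2 (by exact_mod_cast hn)
    set M : Ω → ℝ := fun ω => addFun D n (fun k => Z k ω) with hMdef
    set R : Ω → ℝ := fun ω => Y n ω - M ω with hR
    have hRC : ∀ ω, |R ω| ≤ C := hC n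
    have mR : Measurable R := (hY n).sub (hM n)
    have iR : Integrable R μ := Integrable.of_bound mR.aestronglyMeasurable C
      (Eventually.of_forall hRC)
    have hYM : ∀ ω, Y n ω = M ω + R ω := fun ω => by simp [hR]
    have bR2 : ∀ ω, |R ω ^ 2| ≤ C ^ 2 := fun ω => by
      rw [abs_pow]; exact pow_le_pow_left₀ (abs_nonneg _) (hRC ω) 2
    have bMR : ∀ ω, |2 * M ω * R ω + R ω ^ 2| ≤ C * (M ω ^ 2 / √n + √n) + C ^ 2 := fun ω => by
      -- AM-GM balanced at the scale |M| ≈ √n, so that the cross term is O(√n) in mean and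
      -- disappears after division by n.
      have h1 : 2 * |M ω| ≤ M ω ^ 2 / √n + √n := by
        rw [div_add' _ _ _ hs.ne', le_div_iff₀ hs, ← sq_abs (M ω)]
        nlinarith [sq_nonneg (|M ω| - √n)]
      refine (abs_add_le _ _).trans (add_le_add ?_ (bR2 ω))
      rw [abs_mul, abs_mul, abs_two, mul_comm C]
      exact mul_le_mul h1 (hRC ω) (abs_nonneg _) (by positivity)
    have iB : Integrable (fun ω => C * (M ω ^ 2 / √n + √n) + C ^ 2) μ :=
      ((((iM2 n).div_const _).add (integrable_const _)).const_mul C).add (integrable_const _)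
    have iX : Integrable (fun ω => 2 * M ω * R ω + R ω ^ 2) μ :=
      iB.mono' (by fun_prop) (Eventually.of_forall bMR)
    have iY2 : Integrable (fun ω => Y n ω ^ 2) μ :=
      ((iM2 n).add iX).congr (Eventually.of_forall fun ω => by
        simp only [Pi.add_apply, hYM]; ring)
    have e1 : ∫ ω, Y n ω ∂μ = ∫ ω, R ω ∂μ := by
      simp_rw [hYM]
      rw [integral_add (iM n) iR, h.integral_addFun hD, zero_add]
    have e2 : ∫ ω, Y n ω ^ 2 ∂μ = V n + ∫ ω, (2 * M ω * R ω + R ω ^ 2) ∂μ := by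
      rw [hV, ← integral_add (iM2 n) iX]
      refine integral_congr_ae (Eventually.of_forall fun ω => ?_)
      simp only [hYM]; ring
    have e3 : |∫ ω, R ω ∂μ| ≤ C := by
      have := norm_integral_le_of_norm_le_const (μ := μ) (f := R) (Eventually.of_forall hRC)
      simpa using this
    have e4 : |∫ ω, (2 * M ω * R ω + R ω ^ 2) ∂μ| ≤ C * (V n / √n + √n) + C ^ 2 := by
      have h1 := norm_integral_le_of_norm_le (f := fun ω => 2 * M ω * R ω + R ω ^ 2) iB (Eventually.of_forall bMR)
      have h2 : ∫ ω, C * (M ω ^ 2 / √n + √n) + C ^ 2 ∂μ = C * (V n / √n + √n) + C ^ 2 := by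
        have i3 : Integrable (fun ω => M ω ^ 2 / √(n : ℝ)) μ := (iM2 n).div_const _
        have i4 : Integrable (fun ω => M ω ^ 2 / √(n : ℝ) + √n) μ := i3.add (integrable_const _)
        rw [integral_add (i4.const_mul C) (integrable_const _), integral_const_mul,
          integral_add i3 (integrable_const _), integral_div]
        simp [hV, hMdef]
      rwa [h2, Real.norm_eq_abs] at h1
    have mY2 : MemLp (Y n) 2 μ := (memLp_two_iff_integrable_sq (hY n).aestronglyMeasurable).2 iY2
    have e5 : variance (Y n) μ - V n =
        ∫ ω, (2 * M ω * R ω + R ω ^ 2) ∂μ - (∫ ω, R ω ∂μ) ^ 2 := by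
      rw [variance_eq_sub mY2, e1]
      simp only [Pi.pow_apply]
      rw [e2]
      ring
    rw [e5]
    refine (abs_sub _ _).trans ?_
    have e6 : |(∫ ω, R ω ∂μ) ^ 2| ≤ C ^ 2 := by
      rw [abs_pow]; exact pow_le_pow_left₀ (abs_nonneg _) e3 2
    linarith
  have hdiff : Tendsto (fun n : ℕ => variance (Y n) μ / n - V n / n) atTop (𝓝 0) := by
    have hlim : Tendsto (fun n : ℕ => C * (V n / n * (1 / √n) + 1 / √n) + 2 * C ^ 2 / n) atTop
        (𝓝 0) := by
      have h1 : Tendsto (fun n : ℕ => 1 / √(n : ℝ)) atTop (𝓝 0) := hsqrt.const_div_atTop 1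
      simpa using (((hVlim.mul h1).add h1).const_mul C).add
        (tendsto_const_div_atTop_nhds_zero_nat (2 * C ^ 2))
    refine squeeze_zero_norm' ((eventually_gt_atTop 0).mono fun n hn => ?_) hlim
    have hn' : (0 : ℝ) < n := by exact_mod_cast hn
    have hs : 0 < √(n : ℝ) := Real.sqrt_pos.2 hn'
    have hs2 : (n : ℝ) = √n * √n := (Real.mul_self_sqrt hn'.le).symm
    rw [← sub_div, norm_div, Real.norm_of_nonneg hn'.le, Real.norm_eq_abs, div_le_iff₀ hn']
    refine (hbound n hn).trans_eq ?_
    have h1 : V n / n * (1 / √n) * n = V n / √n := by field_simp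
    have h2 : 1 / √(n : ℝ) * n = √n := by
      rw [div_mul_eq_mul_div, one_mul, div_eq_iff hs.ne', ← hs2]
    have h3 : 2 * C ^ 2 / n * n = 2 * C ^ 2 := by field_simp
    linear_combination -C * h1 - C * h2 - h3
  simpa using hdiff.add hVlim

/-- The central limit theorem for a sequence at bounded distance from a martingale. -/
theorem IsMarkovChain.tendstoInDistribution (h : IsMarkovChain μ ν G Z)
    (hD : IsMartingaleIncrement G D b σ2) (hσ : 0 < σ2) {Y : ℕ → Ω → ℝ}
    (hY : ∀ n, Measurable (Y n)) {C : ℝ}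
    (hC : ∀ n ω, |Y n ω - addFun D n (fun k => Z k ω)| ≤ C) :
    TendstoInDistribution (fun (n : ℕ) ω => Y n ω / (√n * √σ2)) atTop (id : ℝ → ℝ) (fun _ => μ)
      (gaussianReal 0 1) := by
  have hM : ∀ n, Measurable fun ω => addFun D n (fun k => Z k ω) := fun n =>
    measurable_of_dependsOn h.measurable (dependsOn_addFun D n)
  have hsqrt : Tendsto (fun n : ℕ => √(n : ℝ) * √σ2) atTop atTop :=
    (Real.tendsto_sqrt_atTop.comp tendsto_natCast_atTop_atTop).atTop_mul_const (Real.sqrt_pos.2 hσ)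
  -- Slutsky: the normalised difference is at most C/(√n √σ²) everywhere, so the event that it
  -- exceeds a fixed threshold is eventually empty.
  refine tendstoInDistribution_of_tendstoInMeasure_sub
    (X := fun (n : ℕ) ω => addFun D n (fun k => Z k ω) / (√n * √σ2)) _ _ ?_ ?_
    fun n => ((hY n).div_const _).aemeasurable
  · refine ⟨fun n => ((hM n).div_const _).aemeasurable, aemeasurable_id, ?_⟩
    refine ProbabilityMeasure.tendsto_iff_tendsto_charFun.2 fun t => ?_
    have h1 := h.tendsto_integral_exp_addFun hD hσ.le (t / √σ2)
    have h2 : Complex.exp (-(σ2 * ((t / √σ2 : ℝ) : ℂ) ^ 2 / 2)) =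
        charFun (Measure.map id (gaussianReal 0 1)) t := by
      rw [Measure.map_id, charFun_gaussianReal]
      congr 1
      have h3 : σ2 * (t / √σ2) ^ 2 / 2 = t ^ 2 / 2 := by
        rw [div_pow, Real.sq_sqrt hσ.le]
        field_simp
      have h4 : (σ2 * ((t / √σ2 : ℝ) : ℂ) ^ 2 / 2) = t ^ 2 / 2 := by exact_mod_cast h3
      rw [h4]
      simp
    simp only [ProbabilityMeasure.coe_mk]
    rw [← h2]
    refine h1.congr fun n => ?_
    rw [charFun_apply_real, integral_map ((hM n).div_const _).aemeasurable (by fun_prop)]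
    refine integral_congr_ae (Eventually.of_forall fun ω => ?_)
    simp only
    congr 2
    push_cast
    ring
  · rw [tendstoInMeasure_iff_norm]
    intro ε hε
    have hlim : Tendsto (fun n : ℕ => C / (√(n : ℝ) * √σ2)) atTop (𝓝 0) := hsqrt.const_div_atTop C
    refine tendsto_const_nhds.congr' ((hlim.eventually_lt_const hε).mono fun n hn => ?_)
    symm
    convert measure_empty (μ := μ)
    ext ω
    simp only [Set.mem_ofPred_eq, Set.mem_empty_iff_false, iff_false, not_le, Pi.sub_apply,
      Pi.zero_apply, sub_zero]
    rw [← sub_div, norm_div, Real.norm_eq_abs, Real.norm_of_nonneg (by positivity)]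
    exact (div_le_div_of_nonneg_right (hC n ω) (by positivity)).trans_lt hn

end Chain

/-! ### The asymptotic variance of a functional of a mixing chain -/

section Functional

open Matrix

variable {S : Type*} [Fintype S] [DecidableEq S] {G : Matrix S S ℝ} {ρ : S → ℝ}

/-- The martingale increments `g v - (G g) u`. -/
def poissonIncr (G : Matrix S S ℝ) (g : S → ℝ) (u v : S) : ℝ := g v - (G *ᵥ g) u

omit [DecidableEq S] in
theorem sum_poissonIncr (hG1 : ∀ u, ∑ v, G u v = 1) (g : S → ℝ) (u : S) :
    ∑ v, G u v * poissonIncr G g u v = 0 := by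
  simp only [poissonIncr, mul_sub, Finset.sum_sub_distrib, ← Finset.sum_mul, hG1, one_mul]
  exact sub_self _

omit [DecidableEq S] in
theorem sum_poissonIncr_sq (hG1 : ∀ u, ∑ v, G u v = 1) (g : S → ℝ) (u : S) :
    ∑ v, G u v * poissonIncr G g u v ^ 2 =
      (G *ᵥ fun v => g v ^ 2) u - (G *ᵥ g) u ^ 2 := by
  have h1 : ∀ v, G u v * poissonIncr G g u v ^ 2 =
      G u v * g v ^ 2 - 2 * (G *ᵥ g) u * (G u v * g v) + (G *ᵥ g) u ^ 2 * G u v := fun v => by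
    simp only [poissonIncr]; ring
  simp_rw [h1]
  rw [Finset.sum_add_distrib, Finset.sum_sub_distrib, ← Finset.mul_sum, ← Finset.mul_sum, hG1]
  change (G *ᵥ fun v => g v ^ 2) u - 2 * (G *ᵥ g) u * (G *ᵥ g) u + _ = _
  ring

/-- The corrector is the Poisson solution for the conditional variance of the increments, centred at
its stationary mean. -/
theorem IsMixing.isMartingaleIncrement (hG : IsMixing G) (hρ : IsStationaryDist G ρ)
    (g : S → ℝ) : ∃ b, IsMartingaleIncrement G (poissonIncr G g) b
      (∑ u, ρ u * ∑ v, G u v * poissonIncr G g u v ^ 2) := by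
  set h : S → ℝ := fun u => ∑ v, G u v * poissonIncr G g u v ^ 2 with hh
  set σ2 := ∑ u, ρ u * h u with hσ2
  have h0 : ρ ⬝ᵥ (fun u => h u - σ2) = 0 := by
    have : ρ ⬝ᵥ (fun u => h u - σ2) = ρ ⬝ᵥ h - ρ ⬝ᵥ fun _ => σ2 := by
      rw [← dotProduct_sub]; rfl
    rw [this, hρ.dotProduct_const]
    exact sub_self _
  refine ⟨poissonSol G fun u => h u - σ2, hG.sum_eq_one, hG.nonneg,
    sum_poissonIncr hG.sum_eq_one g, fun u => ?_⟩
  have h1 := hG.poissonSol_sub hρ h0 u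
  simp only [mul_add, Finset.sum_add_distrib]
  change h u + (G *ᵥ poissonSol G fun u => h u - σ2) u = _
  linarith

/-- The stationary autocovariance of `f` at lag `t`. -/
def autoCov (G : Matrix S S ℝ) (ρ f : S → ℝ) (t : ℕ) : ℝ :=
  (∑ u, ∑ v, ρ u * f u * (G ^ t) u v * f v) - (∑ u, ρ u * f u) ^ 2

theorem IsMixing.autoCov_eq (hG : IsMixing G) (hρ : IsStationaryDist G ρ) (f : S → ℝ) (t : ℕ) :
    autoCov G ρ f t = ∑ u, ρ u * (f u - ρ ⬝ᵥ f) * (G ^ t *ᵥ fun u => f u - ρ ⬝ᵥ f) u := by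
  set m := ρ ⬝ᵥ f with hm
  have hst := pow_mem hG.mem_rowStochastic t
  rw [Matrix.mem_rowStochastic_iff_sum] at hst
  have h1 : ∀ u, (G ^ t *ᵥ fun u => f u - m) u = (G ^ t *ᵥ f) u - m := fun u => by
    have : (G ^ t *ᵥ fun u => f u - m) = G ^ t *ᵥ f - G ^ t *ᵥ fun _ => m := by
      rw [← mulVec_sub]; rfl
    rw [this, Pi.sub_apply, mulVec_const hst.2]
  have h2 : ∀ u, ρ u * (f u - m) * ((G ^ t *ᵥ f) u - m) =
      ρ u * f u * (G ^ t *ᵥ f) u - m * (ρ u * f u) - m * (ρ u * (G ^ t *ᵥ f) u) +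
        m ^ 2 * ρ u := fun u => by ring
  simp_rw [h1, h2]
  rw [Finset.sum_add_distrib, Finset.sum_sub_distrib, Finset.sum_sub_distrib, ← Finset.mul_sum,
    ← Finset.mul_sum, ← Finset.mul_sum, hρ.sum_eq_one]
  have h3 : ∑ u, ρ u * (G ^ t *ᵥ f) u = m := hρ.dotProduct_pow_mulVec f t
  have h4 : ∑ u, ρ u * f u = m := rfl
  have h5 : ∀ u, ∑ v, ρ u * f u * (G ^ t) u v * f v = ρ u * f u * (G ^ t *ᵥ f) u := fun u => by
    simp only [mulVec, dotProduct, Finset.mul_sum, mul_assoc]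
  rw [autoCov, h3, h4]
  simp_rw [h5]
  ring

omit [DecidableEq S] in
theorem IsStationaryDist.dotProduct_sub_mean (hρ : IsStationaryDist G ρ) (f : S → ℝ) :
    ρ ⬝ᵥ (fun u => f u - ρ ⬝ᵥ f) = 0 := by
  have : ρ ⬝ᵥ (fun u => f u - ρ ⬝ᵥ f) = ρ ⬝ᵥ f - ρ ⬝ᵥ fun _ => ρ ⬝ᵥ f := by
    rw [← dotProduct_sub]; rfl
  rw [this, hρ.dotProduct_const, sub_self]

theorem IsMixing.summable_abs_autoCov (hG : IsMixing G) (hρ : IsStationaryDist G ρ)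
    (f : S → ℝ) : Summable fun t => |autoCov G ρ f t| := by
  refine Summable.abs ?_
  rw [funext (hG.autoCov_eq hρ f)]
  exact summable_sum fun u _ => (hG.summable hρ (hρ.dotProduct_sub_mean f) u).mul_left _

/-- The sum of the autocovariances is the mean conditional variance of the martingale increments. -/
theorem IsMixing.autoCov_add_tsum (hG : IsMixing G) (hρ : IsStationaryDist G ρ) (f : S → ℝ) :
    autoCov G ρ f 0 + 2 * ∑' t : ℕ, autoCov G ρ f (t + 1) =
      ∑ u, ρ u * ∑ v, G u v *
        poissonIncr G (poissonSol G fun u => f u - ρ ⬝ᵥ f) u v ^ 2 := by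
  have h0 := hρ.dotProduct_sub_mean f
  have hs := (hG.summable_abs_autoCov hρ f).of_abs
  have h1 : ∑' t, autoCov G ρ f t =
      ∑ u, ρ u * (f u - ρ ⬝ᵥ f) * poissonSol G (fun u => f u - ρ ⬝ᵥ f) u := by
    simp_rw [hG.autoCov_eq hρ f]
    rw [Summable.tsum_finsetSum fun u _ => (hG.summable hρ h0 u).mul_left _]
    simp_rw [tsum_mul_left]
    rfl
  have h2 := hs.tsum_eq_zero_add
  have h3 : autoCov G ρ f 0 = ∑ u, ρ u * (f u - ρ ⬝ᵥ f) * (f u - ρ ⬝ᵥ f) := by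
    rw [hG.autoCov_eq hρ f 0]; simp
  have h4 := hG.poissonSol_sub hρ h0
  set g := poissonSol G fun u => f u - ρ ⬝ᵥ f
  simp_rw [sum_poissonIncr_sq hG.sum_eq_one g]
  have h5 : ∑ u, ρ u * (G *ᵥ fun v => g v ^ 2) u = ∑ u, ρ u * g u ^ 2 :=
    hρ.dotProduct_mulVec fun v => g v ^ 2
  simp only [mul_sub (ρ _), Finset.sum_sub_distrib, h5]
  -- With φ = f - ρ ⬝ᵥ f = g - Gg, the left side becomes ∑ ρ (2φg - φ²), and 2φg - φ² = g² - (Gg)²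
  -- pointwise.
  have h6 : autoCov G ρ f 0 + 2 * ∑' t : ℕ, autoCov G ρ f (t + 1) =
      2 * ∑' t, autoCov G ρ f t - autoCov G ρ f 0 := by rw [h2]; ring
  rw [h6, h1, h3, Finset.mul_sum, ← Finset.sum_sub_distrib, ← Finset.sum_sub_distrib]
  refine Finset.sum_congr rfl fun u _ => ?_
  rw [← h4 u]
  ring

-- Write g(v) - (Gg)(v) as [g(v) - (Gg)(u)] + [(Gg)(u) - (Gg)(v)]; the second bracket telescopes.
omit [DecidableEq S] in
theorem sum_sub_mean_eq_addFun {f g : S → ℝ} {m : ℝ} (hg : ∀ u, g u - (G *ᵥ g) u = f u - m)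
    (c : ℕ → S) (n : ℕ) :
    ∑ k ∈ Finset.range n, (f (c (k + 1)) - m) =
      addFun (poissonIncr G g) n c + (G *ᵥ g) (c 0) - (G *ᵥ g) (c n) := by
  induction n with
  | zero => simp [addFun]
  | succ n ih =>
    rw [Finset.sum_range_succ, ih, addFun_succ, ← hg]
    simp only [poissonIncr]
    ring

end Functional

/-! ### The chain with gradient information -/

section Gradient

open Matrix

variable {Λ : Type*} [Fintype Λ] [LinearOrder Λ] {P : Matrix Λ Λ ℝ} {π : Λ → ℝ}

theorem gradMatrix_mulVec (h : Λ × ℤˣ × ℤˣ → ℝ) (u : Λ × ℤˣ × ℤˣ) :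
    (gradMatrix P *ᵥ h) u = ∑ s, P u.1 s * h (s, u.2.2, nextGrad u.1 s u.2.2) := by
  simp only [mulVec, dotProduct, gradMatrix, Fintype.sum_prod_type, ite_mul, zero_mul, ite_and,
    Finset.sum_ite_eq', Finset.sum_ite_irrel, Finset.sum_const_zero, Finset.mem_univ, if_true]

/-- The first coordinate evolves by `P` regardless of the gradients, so positivity of powers of `P`
can be transferred. -/
theorem gradMatrix_pow_mulVec_fst (k : Λ → ℝ) (n : ℕ) (u : Λ × ℤˣ × ℤˣ) :
    (gradMatrix P ^ n *ᵥ fun v => k v.1) u = (P ^ n *ᵥ k) u.1 := by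
  induction n generalizing u with
  | zero => simp
  | succ n ih =>
    rw [pow_succ', ← Matrix.mulVec_mulVec, pow_succ', ← Matrix.mulVec_mulVec, gradMatrix_mulVec]
    simp_rw [ih]
    rfl

theorem gradMatrix_sum_eq_one (hP : ∀ r, ∑ s, P r s = 1) (u : Λ × ℤˣ × ℤˣ) :
    ∑ v, gradMatrix P u v = 1 := by
  have := gradMatrix_mulVec (P := P) (fun _ => 1) u
  simpa [mulVec, dotProduct, hP] using this

/-- Without ascents, every power of `P` would vanish above the diagonal, yet some power is entrywise
positive. -/
theorem IsErgodicTransition.exists_lt_pos [Nontrivial Λ] (hP : IsErgodicTransition P) :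
    ∃ t s, t < s ∧ 0 < P t s := by
  by_contra! hcon
  have h0 : ∀ t s, t < s → P t s = 0 := fun t s h =>
    le_antisymm (hcon t s h) (hP.irreducible.nonneg t s)
  have hk : ∀ k t s, t < s → (P ^ k) t s = 0 := by
    intro k
    induction k with
    | zero => intro t s h; simp [h.ne]
    | succ k ih =>
      intro t s h
      rw [pow_succ, mul_apply]
      refine Finset.sum_eq_zero fun l _ => ?_
      rcases lt_or_ge t l with hl | hl
      · rw [ih t l hl, zero_mul]
      · rw [h0 l s (hl.trans_lt h), mul_zero]
  obtain ⟨N, hN⟩ := hP.exists_pow_pos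
  obtain ⟨a, b, hab⟩ := exists_pair_lt Λ
  exact (hN a b).ne' (hk N a b hab)

theorem IsErgodicTransition.sum_eq_one (hP : IsErgodicTransition P) (r : Λ) : ∑ s, P r s = 1 :=
  (Matrix.mem_rowStochastic_iff_sum.1 hP.stochastic).2 r

/-- A state with p_{s,s} = 1 would be absorbing. This makes the denominators 1 - p_{s,s} positive.
-/
theorem IsErgodicTransition.diag_lt_one [Nontrivial Λ] (hP : IsErgodicTransition P) (s : Λ) :
    P s s < 1 := by
  by_contra! hcon
  have h0 : ∀ r, r ≠ s → P s r = 0 := by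
    intro r hr
    have h1 := hP.sum_eq_one s
    rw [← Finset.add_sum_erase _ _ (Finset.mem_univ s)] at h1
    have h2 : P s r ≤ ∑ x ∈ Finset.univ.erase s, P s x :=
      Finset.single_le_sum (f := fun x => P s x) (fun x _ => hP.irreducible.nonneg s x)
        (Finset.mem_erase.2 ⟨hr, Finset.mem_univ r⟩)
    linarith [hP.irreducible.nonneg s r]
  have hk : ∀ k r, r ≠ s → (P ^ k) s r = 0 := by
    intro k
    induction k with
    | zero => intro r h; simp [h.symm]
    | succ k ih =>
      intro r h
      rw [pow_succ, mul_apply]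
      refine Finset.sum_eq_zero fun l _ => ?_
      rcases eq_or_ne l s with rfl | hl
      · rw [h0 r h, mul_zero]
      · rw [ih l hl, zero_mul]
  obtain ⟨N, hN⟩ := hP.exists_pow_pos
  obtain ⟨r, hr⟩ := exists_ne s
  exact (hN s r).ne' (hk N r hr)

omit [Fintype Λ] in
theorem gradMatrix_nonneg (hP : ∀ r s, 0 ≤ P r s) (u v : Λ × ℤˣ × ℤˣ) : 0 ≤ gradMatrix P u v := by
  rw [gradMatrix]
  split_ifs
  · exact hP _ _
  · exact le_rfl

/-- In `N` steps any state can reach first coordinate `t`. The ascent from `t` to `s` forces the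
gradient 1, and one further step to `r` removes the old gradient from memory, so the target `z` does
not depend on the start. -/
theorem IsErgodicTransition.isMixing_gradMatrix [Nontrivial Λ] (hP : IsErgodicTransition P) :
    IsMixing (gradMatrix P) := by
  have hnn := gradMatrix_nonneg hP.irreducible.nonneg
  refine ⟨hnn, gradMatrix_sum_eq_one hP.sum_eq_one, ?_⟩
  obtain ⟨N, hN⟩ := hP.exists_pow_pos
  obtain ⟨t, s, hts, hpos⟩ := hP.exists_lt_pos
  obtain ⟨r, hr⟩ := hP.irreducible.exists_pos s
  set z : Λ × ℤˣ × ℤˣ := (r, 1, nextGrad s r 1)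
  refine ⟨N + 2, z, by omega, fun u => ?_⟩
  set δ := P t s * P s r
  -- The lower bound depends on the first coordinate only, so `gradMatrix_pow_mulVec_fst` evaluates
  -- its image under the `N`-th power.
  have h1 : ∀ v : Λ × ℤˣ × ℤˣ, (if v.1 = t then δ else 0) ≤ (gradMatrix P ^ 2) v z := by
    intro v
    split_ifs with hv
    · rw [pow_two, mul_apply]
      refine le_trans (le_of_eq ?_) (Finset.single_le_sum
        (f := fun w => gradMatrix P v w * gradMatrix P w z)
        (fun w _ => mul_nonneg (hnn _ _) (hnn _ _)) (Finset.mem_univ (s, v.2.2, 1)))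
      simp [gradMatrix, hv, nextGrad, hts, δ, z]
    · exact Matrix.pow_apply_nonneg hnn 2 v z
  have h2 : (gradMatrix P ^ N *ᵥ fun v => if v.1 = t then δ else 0) u = (P ^ N) u.1 t * δ := by
    rw [gradMatrix_pow_mulVec_fst (fun r => if r = t then δ else 0)]
    simp [mulVec, dotProduct]
  have h3 := mulVec_mono (Matrix.pow_apply_nonneg hnn N) h1 u
  rw [h2] at h3
  rw [pow_add]
  exact (mul_pos (hN _ _) (mul_pos hpos hr)).trans_le h3

/-! ### The stationary measures with gradient -/

theorem pairDist_one (s : Λ) : pairDist P π s 1 =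
    (1 - P s s)⁻¹ * ∑ t, if t < s then π t * P t s else 0 := by
  simp [pairDist, show (1 : ℤˣ) ≠ -1 by decide]

theorem pairDist_neg_one (s : Λ) : pairDist P π s (-1) =
    (1 - P s s)⁻¹ * ∑ t, if s < t then π t * P t s else 0 := by
  simp [pairDist, show (-1 : ℤˣ) ≠ 1 by decide]

theorem sum_units {M : Type*} [AddCommMonoid M] (f : ℤˣ → M) : ∑ y, f y = f 1 + f (-1) := by
  rw [UnitsInt.univ, Finset.sum_insert (by decide), Finset.sum_singleton]

/-- This is the stationarity of π at `s`, with the holding term π_s p_{s,s} moved to the other side.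
-/
theorem pairDist_add {s : Λ} (hP : P s s < 1) (hπ : IsStationaryDist P π) :
    pairDist P π s 1 + pairDist P π s (-1) = π s := by
  have h1 : 1 - P s s ≠ 0 := (sub_pos.2 hP).ne'
  rw [pairDist_one, pairDist_neg_one, ← mul_add, inv_mul_eq_iff_eq_mul₀ h1,
    ← Finset.sum_add_distrib]
  have h2 := hπ.stationary s
  have h3 : ∀ t, ((if t < s then π t * P t s else 0) + if s < t then π t * P t s else 0) =
      π t * P t s - if t = s then π s * P s s else 0 := fun t => by
    rcases lt_trichotomy t s with h | rfl | h
    · simp [h, h.not_gt, h.ne]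
    · simp
    · simp [h, h.not_gt, h.ne']
  simp_rw [h3]
  rw [Finset.sum_sub_distrib, h2]
  simp
  ring

/-- Gradient `y` at `r` arises either from a strict step in direction `y`, whatever the old
gradient, or from holding at `r` with `y` already present. The factor (1 - p_{r,r})⁻¹ in `pairDist`
solves this balance. -/
theorem sum_gradDist (hP : ∀ s, P s s < 1) (hπ : IsStationaryDist P π) (r : Λ) (y : ℤˣ) :
    ∑ a, gradDist P π (r, a, y) = pairDist P π r y := by
  have h1 : 1 - P r r ≠ 0 := (sub_pos.2 (hP r)).ne'
  rw [sum_units]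
  simp only [gradDist, ← Finset.sum_add_distrib]
  rcases Int.units_eq_one_or y with rfl | rfl
  · have h3 : ∀ s, ((if (1 : ℤˣ) = nextGrad s r 1 then pairDist P π s 1 * P s r else 0) +
        if (1 : ℤˣ) = nextGrad s r (-1) then pairDist P π s (-1) * P s r else 0) =
        (if s < r then π s * P s r else 0) +
          if s = r then pairDist P π r 1 * P r r else 0 := fun s => by
      rcases lt_trichotomy s r with h | rfl | h
      · simp [nextGrad, h, h.ne, ← pairDist_add (hP s) hπ, add_mul]
      · simp [nextGrad, show (1 : ℤˣ) ≠ -1 by decide]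
      · simp [nextGrad, h, h.not_gt, h.ne', show (1 : ℤˣ) ≠ -1 by decide]
    simp_rw [h3]
    rw [Finset.sum_add_distrib]
    simp only [Finset.sum_ite_eq', Finset.mem_univ, if_true]
    rw [pairDist_one]
    field_simp
    ring
  · have h3 : ∀ s, ((if (-1 : ℤˣ) = nextGrad s r 1 then pairDist P π s 1 * P s r else 0) +
        if (-1 : ℤˣ) = nextGrad s r (-1) then pairDist P π s (-1) * P s r else 0) =
        (if r < s then π s * P s r else 0) +
          if s = r then pairDist P π r (-1) * P r r else 0 := fun s => by
      rcases lt_trichotomy s r with h | rfl | h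
      · simp [nextGrad, h, h.not_gt, h.ne, show (-1 : ℤˣ) ≠ 1 by decide]
      · simp [nextGrad, show (-1 : ℤˣ) ≠ 1 by decide]
      · simp [nextGrad, h, h.not_gt, h.ne', ← pairDist_add (hP s) hπ, add_mul]
    simp_rw [h3]
    rw [Finset.sum_add_distrib]
    simp only [Finset.sum_ite_eq', Finset.mem_univ, if_true]
    rw [pairDist_neg_one]
    field_simp
    ring

/-- A transition ignores the older gradient. Summing it out leaves `pairDist`, whose one-step image
is `gradDist` by definition. -/
theorem IsErgodicTransition.isStationaryDist_gradDist [Nontrivial Λ] (hP : IsErgodicTransition P)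
    (hπ : IsStationaryDist P π) : IsStationaryDist (gradMatrix P) (gradDist P π) where
  nonneg u := by
    refine Finset.sum_nonneg fun s _ => ?_
    split_ifs
    · refine mul_nonneg (mul_nonneg (inv_nonneg.2 (sub_pos.2 (hP.diag_lt_one s)).le)
        (Finset.sum_nonneg fun t _ => ?_)) (hP.irreducible.nonneg _ _)
      split_ifs
      · exact mul_nonneg (hπ.nonneg t) (hP.irreducible.nonneg _ _)
      · exact le_rfl
    · exact le_rfl
  sum_eq_one := by
    simp only [Fintype.sum_prod_type]
    have h1 : ∀ r, ∑ a, ∑ b, gradDist P π (r, a, b) = π r := fun r => by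
      rw [Finset.sum_comm]
      simp_rw [sum_gradDist hP.diag_lt_one hπ]
      rw [sum_units, pairDist_add (hP.diag_lt_one r) hπ]
    simp_rw [h1, hπ.sum_eq_one]
  stationary v := by
    obtain ⟨s, b, c⟩ := v
    simp only [Fintype.sum_prod_type]
    have h1 : ∀ r, ∑ a, ∑ b', gradDist P π (r, a, b') * gradMatrix P (r, a, b') (s, b, c) =
        if c = nextGrad r s b then pairDist P π r b * P r s else 0 := fun r => by
      simp only [gradMatrix, ite_and, mul_ite, mul_zero, Finset.sum_ite_eq, Finset.mem_univ,
        if_true]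
      rw [← sum_gradDist hP.diag_lt_one hπ]
      split_ifs
      · rw [Finset.sum_mul]
      · simp
    simp_rw [h1]
    rfl

/-- A change from 1 to -1 is a strict descent made with gradient 1, which gives the peak sum
`oscPos`; the opposite change gives `oscNeg`. -/
theorem sum_gradDist_turn : gradDist P π ⬝ᵥ turn = osc P π := by
  simp only [dotProduct, Fintype.sum_prod_type, sum_units, turn, osc, oscPos, oscNeg, gradDist]
  simp [show (1 : ℤˣ) ≠ -1 by decide]
  have h1 : ∀ s r : Λ, (-1 : ℤˣ) = nextGrad s r 1 ↔ r < s := fun s r => by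
    rcases lt_trichotomy s r with h | rfl | h
    · simp [nextGrad, h, h.not_gt, show (-1 : ℤˣ) ≠ 1 by decide]
    · simp [nextGrad, show (-1 : ℤˣ) ≠ 1 by decide]
    · simp [nextGrad, h, h.not_gt]
  have h2 : ∀ s r : Λ, (1 : ℤˣ) = nextGrad s r (-1) ↔ s < r := fun s r => by
    rcases lt_trichotomy s r with h | rfl | h
    · simp [nextGrad, h]
    · simp [nextGrad, show (1 : ℤˣ) ≠ -1 by decide]
    · simp [nextGrad, h, h.not_gt, show (1 : ℤˣ) ≠ -1 by decide]
  simp_rw [h1, h2]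
  rw [Finset.sum_add_distrib]
  congr 1
  · rw [Finset.sum_comm]
    conv_rhs => rw [Finset.sum_comm]
    refine Finset.sum_congr rfl fun s _ => ?_
    conv_rhs => rw [Finset.sum_comm]
    refine Finset.sum_congr rfl fun r _ => ?_
    rw [pairDist_one]
    split_ifs with h
    · rw [Finset.mul_sum, Finset.sum_mul]
      refine Finset.sum_congr rfl fun t _ => ?_
      by_cases ht : t < s
      · simp only [ht, h, and_self, if_true]; ring
      · simp [ht]
    · simp [h]
  · rw [Finset.sum_comm]
    conv_rhs => rw [Finset.sum_comm]
    refine Finset.sum_congr rfl fun s _ => ?_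
    conv_rhs => rw [Finset.sum_comm]
    refine Finset.sum_congr rfl fun r _ => ?_
    rw [pairDist_neg_one]
    split_ifs with h
    · rw [Finset.mul_sum, Finset.sum_mul]
      refine Finset.sum_congr rfl fun t _ => ?_
      by_cases ht : s < t
      · simp only [ht, h, and_self, if_true]; ring
      · simp [ht]
    · simp [h]

/-! ### The augmented path as a Markov chain -/

/-- The chain `(x_k, y_{k-1}, y_k)` along the path `c`, with initial gradients `1`. -/
def gradState {Λ : Type*} [LinearOrder Λ] (c : ℕ → Λ) (k : ℕ) : Λ × ℤˣ × ℤˣ :=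
  (c k, gradSeq c (k - 1), gradSeq c k)

omit [Fintype Λ] in
theorem gradState_congr {c d : ℕ → Λ} {n : ℕ} (h : ∀ k ≤ n, c k = d k) :
    gradState c n = gradState d n := by
  rw [gradState, gradState, h n le_rfl, gradSeq_congr h,
    gradSeq_congr fun k hk => h k (hk.trans (Nat.sub_le n 1))]

-- The sum starts at index 1, so the truncated `k - 1` at time 0 in `gradState` does not enter.
omit [Fintype Λ] in
theorem turnCount_eq_sum (c : ℕ → Λ) (n : ℕ) :
    (turnCount c n : ℝ) = ∑ k ∈ Finset.range n, turn (gradState c (k + 1)) := by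
  induction n with
  | zero => simp [turnCount]
  | succ n ih =>
    rw [Finset.sum_range_succ, ← ih, turnCount]
    simp [turn, gradState]

/-- `(x_k, y_{k-1}, y_k)` is a Markov chain. -/
theorem IsMarkovChain.gradState {Ω : Type*} [MeasurableSpace Λ] [MeasurableSingletonClass Λ]
    [MeasurableSpace Ω] [MeasurableSpace (Λ × ℤˣ × ℤˣ)] {μ : Measure Ω} {x : ℕ → Ω → Λ}
    (hx : IsMarkovChain μ π P x) :
    IsMarkovChain μ (fun u => μ.real {ω | gradState (fun k => x k ω) 0 = u}) (gradMatrix P)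
      (fun k ω => gradState (fun k => x k ω) k) where
  measurable n := measurable_of_dependsOn hx.measurable (F := fun c => MarkovAlt.gradState c n)
    (n := n) fun c d h => gradState_congr h
  initial _ := rfl
  markov n s := by
    set A : Set Ω := {ω | ∀ k ≤ n, MarkovAlt.gradState (fun k => x k ω) k = s k} with hA
    set A' : Set Ω := {ω | ∀ k ≤ n + 1, MarkovAlt.gradState (fun k => x k ω) k = s k} with hA'
    have hstep : ∀ ω ∈ A, MarkovAlt.gradState (fun k => x k ω) (n + 1) =
        (x (n + 1) ω, (s n).2.2, nextGrad (s n).1 (x (n + 1) ω) (s n).2.2) := fun ω hω => by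
      rw [← hω n le_rfl]; rfl
    have hsub : A' ⊆ A := fun ω hω k hk => hω k (hk.trans (Nat.le_succ n))
    by_cases hA0 : A = ∅
    · have : A' = ∅ := Set.subset_eq_empty hsub hA0
      simp [hA0, this]
    obtain ⟨ω₀, hω₀⟩ := Set.nonempty_iff_ne_empty.2 hA0
    -- Gradients are functions of the path. Once one outcome realises the prescribed states,
    -- prescribing the first coordinates is enough.
    have hAeq : A = {ω | ∀ k ≤ n, x k ω = (s k).1} := by
      ext ω
      refine ⟨fun hω k hk => by rw [← hω k hk]; rfl, fun hω k hk => ?_⟩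
      rw [← hω₀ k hk]
      refine gradState_congr fun j hj => ?_
      have h1 := hω₀ j (hj.trans hk)
      have h2 : x j ω₀ = (s j).1 := by rw [← h1]; rfl
      rw [hω j (hj.trans hk), h2]
    rw [gradMatrix]
    split_ifs with hs
    · have hA'eq : A' = {ω | ∀ k ≤ n + 1, x k ω = (s k).1} := by
        ext ω
        refine ⟨fun hω k hk => by rw [← hω k hk]; rfl, fun hω k hk => ?_⟩
        have hωA : ω ∈ A := by
          rw [hAeq]; exact fun k hk => hω k (hk.trans (Nat.le_succ n))
        rcases hk.lt_or_eq with hk | rfl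
        · exact hωA k (Nat.lt_succ_iff.1 hk)
        · rw [hstep ω hωA, hω (n + 1) le_rfl, ← hs.1]
          refine Prod.ext rfl (Prod.ext rfl ?_)
          rw [hs.2, hs.1]
      rw [hA'eq, hAeq]
      exact hx.markov n fun k => (s k).1
    · have : A' = ∅ := by
        refine Set.eq_empty_iff_forall_notMem.2 fun ω hω => hs ?_
        have h1 := hstep ω (hsub hω)
        rw [hω (n + 1) le_rfl] at h1
        rw [h1]
        exact ⟨rfl, rfl⟩
      simp [this]

end Gradient

end MarkovAlt

/-! ### Assembly -/

theorem mainTheorem10 {Λ Ω : Type*} [Fintype Λ] [LinearOrder Λ] [MeasurableSpace Λ]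
    [MeasurableSingletonClass Λ] [MeasurableSpace Ω] (μ : Measure Ω) [IsProbabilityMeasure μ]
    (P : Matrix Λ Λ ℝ) (π : Λ → ℝ) (x : ℕ → Ω → Λ)
    (hP : MarkovAlt.IsErgodicTransition P) (hπ : MarkovAlt.IsStationaryDist P π)
    (hx : MarkovAlt.IsMarkovChain μ π P x) :
    Summable (fun t : ℕ => |MarkovAlt.turnCov P π (t + 1)|) ∧
    0 ≤ MarkovAlt.asymptoticVariance P π ∧
    Tendsto
      (fun n : ℕ =>
        variance (fun ω => (MarkovAlt.longestAlt (fun i : Fin (n + 1) => x i ω) : ℝ)) μ / n)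
      atTop (𝓝 (MarkovAlt.asymptoticVariance P π)) ∧
    (MarkovAlt.asymptoticVariance P π ≠ 0 →
      TendstoInDistribution
        (fun (n : ℕ) (ω : Ω) =>
          ((MarkovAlt.longestAlt (fun i : Fin (n + 1) => x i ω) : ℝ) - n * MarkovAlt.osc P π) /
            (√n * √(MarkovAlt.asymptoticVariance P π)))
        atTop (id : ℝ → ℝ) (fun _ => μ) (gaussianReal 0 1)) := by
  open MarkovAlt in
  have hLA : ∀ n ω, longestAlt (fun i : Fin (n + 1) => x i ω) =
      turnCount (fun k => x k ω) n + 1 := fun n ω => longestAlt_eq_turnCount (fun k => x k ω) n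
  -- With one state there is no ascent to erase the gradient and 1 - p_{s,s} = 0, so the mixing
  -- argument fails. Here all covariances vanish and the path has no turns.
  rcases subsingleton_or_nontrivial Λ with hΛ | hΛ
  · have hcov : ∀ t, turnCov P π t = 0 := fun t => by
      have h0 : ∀ u, gradDist P π u = 0 := fun u => by
        refine Finset.sum_eq_zero fun s _ => ?_
        have : ∀ t, ¬ t < s ∧ ¬ s < t := fun t => by simp [Subsingleton.elim t s]
        simp [pairDist, this]
      simp [turnCov, h0]
    have hV : asymptoticVariance P π = 0 := by simp [asymptoticVariance, hcov]
    have h1 : ∀ n ω, longestAlt (fun i : Fin (n + 1) => x i ω) = longestAlt fun i : Fin (n + 1) =>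
        x 0 ω := fun n ω => by
      congr 1
      exact funext fun i => Subsingleton.elim _ _
    have h2 : ∀ n (ω : Ω), turnCount (fun k => x k ω) n = 0 := fun n ω => by
      have hg : ∀ n, gradSeq (fun k => x k ω) n = 1 := fun n => by
        induction n with
        | zero => rfl
        | succ n ih =>
          rw [gradSeq, ih, nextGrad, Subsingleton.elim (x n ω) (x (n + 1) ω)]
          simp
      induction n with
      | zero => rfl
      | succ n ih => rw [turnCount, ih, hg, hg]; simp [show (1 : ℤˣ) ≠ -1 by decide]
    refine ⟨by simp [hcov], hV.ge, ?_, fun h => (h hV).elim⟩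
    have h3 : ∀ n : ℕ, variance (fun ω => (longestAlt (fun i : Fin (n + 1) => x i ω) : ℝ)) μ / n =
        0 := fun n => by
      simp only [hLA, h2]
      rw [variance_eq_integral aemeasurable_const]
      simp
    simp_rw [h3, hV]
    exact tendsto_const_nhds
  · let _ : MeasurableSpace (Λ × ℤˣ × ℤˣ) := ⊤
    have : MeasurableSingletonClass (Λ × ℤˣ × ℤˣ) := ⟨fun _ => trivial⟩
    have hG := hP.isMixing_gradMatrix
    have hρ := hP.isStationaryDist_gradDist hπ
    have hcov : turnCov P π = autoCov (gradMatrix P) (gradDist P π) turn := rfl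
    have hsum := hG.summable_abs_autoCov hρ turn
    have hvar := hG.autoCov_add_tsum hρ turn
    have h0 := hρ.dotProduct_sub_mean turn
    have hpoisson := hG.poissonSol_sub hρ h0
    set g := poissonSol (gradMatrix P) fun u => turn u - gradDist P π ⬝ᵥ turn
    obtain ⟨b, hb⟩ := hG.isMartingaleIncrement hρ g
    rw [← hvar] at hb
    have hV : asymptoticVariance P π = autoCov (gradMatrix P) (gradDist P π) turn 0 +
      2 * ∑' t : ℕ, autoCov (gradMatrix P) (gradDist P π) turn (t + 1) := rfl
    rw [← hV] at hb hvar
    have hV0 : 0 ≤ asymptoticVariance P π := by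
      rw [hvar]
      exact Finset.sum_nonneg fun u _ => mul_nonneg (hρ.nonneg u) <|
        Finset.sum_nonneg fun v _ => mul_nonneg (hG.nonneg u v) (sq_nonneg _)
    -- The initial law has both gradients equal to 1 and is not `gradDist P π`; the limit theorems
    -- for the martingale allow any initial law.
    have hZ := hx.gradState
    rw [sum_gradDist_turn] at hpoisson
    set Y : ℕ → Ω → ℝ := fun n ω =>
      (longestAlt (fun i : Fin (n + 1) => x i ω) : ℝ) - n * osc P π with hYdef
    have hmeas : ∀ n, Measurable fun ω => (longestAlt (fun i : Fin (n + 1) => x i ω) : ℝ) :=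
      fun n => by
        have : Measurable fun p : Fin (n + 1) → Λ => (longestAlt p : ℝ) := Measurable.of_discrete
        exact this.comp (measurable_path hx.measurable n)
    have hY : ∀ n, Measurable (Y n) := fun n => (hmeas n).sub_const _
    set B := ∑ u, |(gradMatrix P).mulVec g u|
    have hB : ∀ u, |(gradMatrix P).mulVec g u| ≤ B := fun u =>
      Finset.single_le_sum (f := fun u => |(gradMatrix P).mulVec g u|) (fun _ _ => abs_nonneg _)
        (Finset.mem_univ u)
    -- The 1 is the offset between the length and the number of turns; each `B` bounds one boundary
    -- value of Gg.
    have hC : ∀ n ω, |Y n ω - addFun (poissonIncr (gradMatrix P) g) n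
        (fun k => gradState (fun k => x k ω) k)| ≤ 1 + B + B := fun n ω => by
      have h1 := sum_sub_mean_eq_addFun hpoisson (gradState fun k => x k ω) n
      rw [Finset.sum_sub_distrib, ← turnCount_eq_sum] at h1
      simp only [Finset.sum_const, Finset.card_range, nsmul_eq_mul] at h1
      have h2 : Y n ω - addFun (poissonIncr (gradMatrix P) g) n
          (fun k => gradState (fun k => x k ω) k) =
          1 + (gradMatrix P).mulVec g (gradState (fun k => x k ω) 0) -
            (gradMatrix P).mulVec g (gradState (fun k => x k ω) n) := by
        simp only [hYdef, hLA]
        push_cast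
        linarith
      rw [h2]
      refine (abs_sub _ _).trans (add_le_add ((abs_add_le _ _).trans ?_) (hB _))
      rw [abs_one]
      exact add_le_add le_rfl (hB _)
    refine ⟨?_, hV0, ?_, fun hne => ?_⟩
    · exact (summable_nat_add_iff 1).2 hsum
    · refine (hZ.tendsto_variance_div hb hY hC).congr fun n => ?_
      rw [variance_sub_const (hmeas n).aestronglyMeasurable]
    · exact hZ.tendstoInDistribution hb (hV0.lt_of_ne' hne) hY hC
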